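/- Let $0<\kappa\le\sigma<1$. There exist $c,\varepsilon,\delta_0\in(0,1]$, depending only on $\kappa$ and $\sigma$, such that the following holds for all $0<\delta<\delta_0$. Let $|\cdot|$ denote Lebesgue measure on $\mathbb{R}$ and let $B(x,r)$ denote the closed ball with centre $x$ and radius $r$. Let $A\subset\mathbb{R}$ be a nonempty $(\delta,\kappa,\delta^{-\varepsilon})$-set with $|A|\le\delta^{1-\sigma}$; that is, $A$ is a nonempty finite union of balls of radius $\delta$, $|A|\le\delta^{1-\sigma}$, and $$|A\cap B(x,r)|\le\delta^{-\varepsilon}r^{\kappa}|A|\quad\text{for all }x\in A\text{ and all }r\ge\delta.$$ Let $\mu$ be a $(\kappa,\delta^{-\varepsilon})$-measure supported on $[0,1]$; that is, $\mu$ is a Borel probability measure on $\mathbb{R}$ whose support $\operatorname{spt}\mu$ is contained in $[0,1]$, and $$\mu(B(x,r))\le\delta^{-\varepsilon}r^{\kappa}\quad\text{for all }x\in\operatorname{spt}\mu\text{ and all }r>0.$$ Then there exists $x\in\operatorname{spt}\mu$ such that $$|A+xA|>\delta^{-c}|A|,$$ where $A+xA=\{a+xb : a,b\in A\}$. -/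

import Mathlib

open MeasureTheory
open scoped Pointwise ENNReal

/-- A set `A ⊆ ℝ` is a `(δ, κ, C)`-set if it is a finite union of (closed) balls of radius `δ` and
`|A ∩ B(x, r)| ≤ C r ^ κ |A|` for all `x ∈ A` and all `r ≥ δ`, with `|·|` Lebesgue measure. -/
def IsDeltaSet (δ κ C : ℝ) (A : Set ℝ) : Prop :=
  (∃ s : Finset ℝ, A = ⋃ y ∈ s, Metric.closedBall y δ) ∧
    ∀ x ∈ A, ∀ r : ℝ, δ ≤ r →
      volume (A ∩ Metric.closedBall x r) ≤ ENNReal.ofReal (C * r ^ κ) * volume A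

/-- A Borel probability measure `μ` on `ℝ` (such a measure is automatically Radon) is a
`(κ, C)`-measure if `μ (B(x, r)) ≤ C r ^ κ` for all `x` in its (topological) support and all
`r > 0`. -/
def IsFrostmanMeasure (κ C : ℝ) (μ : Measure ℝ) : Prop :=
  IsProbabilityMeasure μ ∧
    ∀ x ∈ μ.support, ∀ r : ℝ, 0 < r →
      μ (Metric.closedBall x r) ≤ ENNReal.ofReal (C * r ^ κ)

/-!
Suppose that `|A + x A| ≤ δ ^ (-c) |A|` for all `x` in the support `X` of `μ`. Rescaling by `δ` and
rounding, `A` becomes a finite set `S` of integers. The idea is that `X` then generates a ring of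
dilations under which `S` is almost invariant, that a ring of positive dimension must fill the unit
interval, and that almost all dilations expand `S`.

*The ring of multipliers.* A real number `z` is an `L`-multiplier of `S` if `⌊z S⌋` is covered by `L`
translates of `S - S`. The assumption, Ruzsa's inequalities and Plünnecke's inequality show that `S`
has small doubling and that the points of `X` are multipliers. By Ruzsa's covering lemma, sums and
products of `L`-multipliers are `L ^ 5`-multipliers, so the multipliers form a filtered ring
(`isFilteredRing_multipliers`), in which boundedly many operations cost only a small power of `δ`.

*A ring of positive dimension is full.* Let `M r` be the number of intervals of length `r` that meet
the ring. By pigeonholing the level of the filtration, one can assume that `M` hardly changes under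
ring operations (`IsFilteredRing.exists_stable_level`). Multiplying by an element of size `d` and
adding `d`-separated elements gives `M (d r) ≥ M d * M r`, up to small factors. This is not sharp:
if `M r` is much smaller than `1 / r`, then `M (d r) ≥ M r * M d ^ 2`
(`IsStableRing.mul_sq_le_cellCount_add`). To see this, consider quotients `b = r₁ / r₂` of ring
elements with `r₂` of size about `d`. If some `b / 2` or `(b + 1) / 2` is not close to such a
quotient, then `(p, q) ↦ p + b' q`, with `b'` this number, is injective on the ring at scale `r`
except for `|q - q'| < d`; otherwise the quotients are dense in `[0, 1]`
(`exists_near_of_halving`), and `(p, q) ↦ p + b' q` has few collisions for an average quotient `b'`.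
In both cases Cauchy–Schwarz gives `M r * M d` values at scale `r`. After multiplication by `r₂`
these are ring elements of size about `d`, of which there are about `M (d r) / M d` at scale `d r`.
Working with elements of size `d` at scale `d r` ensures that the small denominator `r₂` costs
nothing. Iterating the two inequalities, `M r` is close to `1 / r` at the scale `r = δ`
(`exists_almost_full`, `exists_level_cellCount_ge`).

*Conclusion.* There are now about `1 / δ` multipliers in different intervals of length `δ`. As `A`
has non-concentration and `|S| ≤ δ ^ (-σ)` with `σ < 1`, the average of `|S + ⌊z S⌋|` over these
multipliers `z` is much larger than `|S|` (`card_le_of_card_add_le`), a contradiction.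
-/

/-! ### Counting cells -/

section Counting

variable {ι : Type*}

lemma card_le_mul_card_image_real [DecidableEq ι] {β : Type*} [DecidableEq β] (s : Finset ι)
    (f : ι → β) (m : ℝ) (h : ∀ b ∈ s.image f, ((s.filter (fun i ↦ f i = b)).card : ℝ) ≤ m) :
    (s.card : ℝ) ≤ m * (s.image f).card := by
  rw [Finset.card_eq_sum_card_image f s]
  push_cast
  calc _ ≤ ∑ b ∈ s.image f, m := Finset.sum_le_sum h
    _ = m * (s.image f).card := by rw [Finset.sum_const, nsmul_eq_mul, mul_comm]

/-- An interval of length `ℓ` meets at most `ℓ / r + 2` cells `[k r, (k + 1) r)`. -/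
lemma card_le_of_injOn_floor (s : Finset ι) (f : ι → ℝ) {r x ℓ : ℝ} (hr : 0 < r) (hℓ : 0 ≤ ℓ)
    (hinj : Set.InjOn (fun i ↦ ⌊f i / r⌋) s) (hf : ∀ i ∈ s, x ≤ f i ∧ f i ≤ x + ℓ) :
    (s.card : ℝ) ≤ ℓ / r + 2 := by
  have h1 : s.card ≤ (Finset.Icc ⌊x / r⌋ ⌊(x + ℓ) / r⌋).card := by
    refine Finset.card_le_card_of_injOn _ (fun i hi ↦ ?_) hinj
    obtain ⟨h1, h2⟩ := hf i hi
    simp only [Finset.coe_Icc, Set.mem_Icc]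
    exact ⟨Int.floor_le_floor (by gcongr), Int.floor_le_floor (by gcongr)⟩
  rw [Int.card_Icc] at h1
  have h2 : ⌊x / r⌋ ≤ ⌊(x + ℓ) / r⌋ := Int.floor_le_floor (by gcongr; linarith)
  have h3 : (s.card : ℤ) ≤ ⌊(x + ℓ) / r⌋ + 1 - ⌊x / r⌋ := by omega
  have h4 : (s.card : ℝ) ≤ ⌊(x + ℓ) / r⌋ + 1 - ⌊x / r⌋ := by exact_mod_cast h3
  have h5 := Int.floor_le ((x + ℓ) / r)
  have h6 := Int.lt_floor_add_one (x / r)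
  have h7 : (x + ℓ) / r = x / r + ℓ / r := add_div _ _ _
  linarith

end Counting

/-! ### Approximate multipliers of a finite set of integers -/

/-- The real number `z` is an `L`-multiplier of the finite set `S` of integers if the rounded dilate
`⌊z S⌋` is covered by `L` translates of `S - S`. -/
def IsMultiplier (S : Finset ℤ) (L z : ℝ) : Prop :=
  ∃ T : Finset ℤ, (T.card : ℝ) ≤ L ∧
    ∀ a ∈ S, ∃ t ∈ T, ∃ u ∈ S, ∃ v ∈ S, ⌊z * a⌋ = t + u - v

/-- `2S - 2S` is covered by `L` translates of `S - S`. -/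
def SumsetCovered (S : Finset ℤ) (L : ℝ) : Prop :=
  ∃ F : Finset ℤ, (F.card : ℝ) ≤ L ∧
    ∀ u₁ ∈ S, ∀ u₂ ∈ S, ∀ v₁ ∈ S, ∀ v₂ ∈ S, ∃ f ∈ F, ∃ u ∈ S, ∃ v ∈ S,
      u₁ + u₂ - v₁ - v₂ = f + u - v

section Multiplier

variable {S : Finset ℤ} {L L' z w : ℝ}

lemma IsMultiplier.mono (h : IsMultiplier S L z) (hL : L ≤ L') : IsMultiplier S L' z := by
  obtain ⟨T, hT, h⟩ := h
  exact ⟨T, hT.trans hL, h⟩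

lemma SumsetCovered.mono (h : SumsetCovered S L) (hL : L ≤ L') : SumsetCovered S L' := by
  obtain ⟨T, hT, h⟩ := h
  exact ⟨T, hT.trans hL, h⟩

lemma isMultiplier_one (hS : S.Nonempty) (hL : 1 ≤ L) : IsMultiplier S L 1 := by
  obtain ⟨s, hs⟩ := hS
  exact ⟨{s}, by simpa using hL, fun a ha ↦ ⟨s, by simp, a, ha, s, hs, by simp⟩⟩

lemma card_add_le_mul {A B : Finset ℤ} {x y : ℝ} (hA : (A.card : ℝ) ≤ x) (hB : (B.card : ℝ) ≤ y) :
    ((A + B).card : ℝ) ≤ x * y := by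
  calc ((A + B).card : ℝ) ≤ A.card * B.card := by exact_mod_cast Finset.card_add_le
    _ ≤ x * y := by gcongr; exact (Nat.cast_nonneg _).trans hA

lemma card_sub_le_mul {A B : Finset ℤ} {x y : ℝ} (hA : (A.card : ℝ) ≤ x) (hB : (B.card : ℝ) ≤ y) :
    ((A - B).card : ℝ) ≤ x * y := by
  calc ((A - B).card : ℝ) ≤ A.card * B.card := by exact_mod_cast Finset.card_sub_le
    _ ≤ x * y := by gcongr; exact (Nat.cast_nonneg _).trans hA

lemma IsMultiplier.neg (hL : 11 ≤ L) (hz : IsMultiplier S L z) : IsMultiplier S (L ^ 5) (-z) := by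
  obtain ⟨T, hT, h⟩ := hz
  refine ⟨Finset.Icc (-5) 5 - T, ?_, fun a ha ↦ ?_⟩
  · refine (card_sub_le_mul (x := L) (y := L) (by simpa using hL) hT).trans ?_
    rw [← pow_two]
    exact pow_le_pow_right₀ (by linarith) (by norm_num)
  · obtain ⟨t, ht, u, hu, v, hv, e⟩ := h a ha
    have h1 := Int.floor_le (z * a)
    have h2 := Int.lt_floor_add_one (z * a)
    have h3 := Int.floor_le (-z * a)
    have h4 := Int.lt_floor_add_one (-z * a)
    refine ⟨⌊-z * a⌋ + ⌊z * a⌋ - t, Finset.sub_mem_sub ?_ ht, v, hv, u, hu, by rw [e]; ring⟩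
    rw [Finset.mem_Icc]
    constructor <;> rw [← Int.cast_le (R := ℝ)] <;> push_cast <;> linarith

lemma IsMultiplier.add (hL : 11 ≤ L) (hF : SumsetCovered S L) (hz : IsMultiplier S L z)
    (hw : IsMultiplier S L w) : IsMultiplier S (L ^ 5) (z + w) := by
  obtain ⟨T, hT, h⟩ := hz
  obtain ⟨T', hT', h'⟩ := hw
  obtain ⟨F, hFc, hF⟩ := hF
  refine ⟨Finset.Icc (-5) 5 + T + T' + F, ?_, fun a ha ↦ ?_⟩
  · refine (card_add_le_mul (card_add_le_mul (card_add_le_mul (x := L)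
      (by simpa using hL) hT) hT') hFc).trans ?_
    calc L * L * L * L = L ^ 4 := by ring
      _ ≤ L ^ 5 := pow_le_pow_right₀ (by linarith) (by norm_num)
  · obtain ⟨t, ht, u, hu, v, hv, e⟩ := h a ha
    obtain ⟨t', ht', u', hu', v', hv', e'⟩ := h' a ha
    obtain ⟨f, hf, x, hx, y, hy, e''⟩ := hF u hu u' hu' v hv v' hv'
    have h1 := Int.floor_le (z * a)
    have h2 := Int.lt_floor_add_one (z * a)
    have h3 := Int.floor_le (w * a)
    have h4 := Int.lt_floor_add_one (w * a)
    have h5 := Int.floor_le ((z + w) * a)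
    have h6 := Int.lt_floor_add_one ((z + w) * a)
    have h7 : (z + w) * a = z * a + w * a := by ring
    refine ⟨⌊(z + w) * a⌋ - ⌊z * a⌋ - ⌊w * a⌋ + t + t' + f, Finset.add_mem_add (Finset.add_mem_add
      (Finset.add_mem_add ?_ ht) ht') hf, x, hx, y, hy, by rw [e, e']; linarith⟩
    rw [Finset.mem_Icc]
    constructor <;> rw [← Int.cast_le (R := ℝ)] <;> push_cast <;> linarith

lemma IsMultiplier.mul (hL : 11 ≤ L) (hF : SumsetCovered S L) (hz : IsMultiplier S L z)
    (hw : IsMultiplier S L w) (hz4 : |z| ≤ 4) : IsMultiplier S (L ^ 5) (z * w) := by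
  obtain ⟨T, hT, h⟩ := hz
  obtain ⟨T', hT', h'⟩ := hw
  obtain ⟨F, hFc, hF⟩ := hF
  refine ⟨Finset.Icc (-5) 5 + T'.image (fun t : ℤ ↦ ⌊z * t⌋) + (T - T) + F, ?_, fun a ha ↦ ?_⟩
  · refine (card_add_le_mul (card_add_le_mul (card_add_le_mul (x := L) (y := L)
      (by simpa using hL) ?_) (card_sub_le_mul hT hT)) hFc).trans ?_
    · exact le_trans (by exact_mod_cast Finset.card_image_le) hT'
    · exact le_of_eq (by ring)
  · obtain ⟨t', ht', u', hu', v', hv', e'⟩ := h' a ha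
    obtain ⟨t, ht, u, hu, v, hv, e⟩ := h u' hu'
    obtain ⟨t₂, ht₂, u₂, hu₂, v₂, hv₂, e₂⟩ := h v' hv'
    obtain ⟨f, hf, x, hx, y, hy, e''⟩ := hF u hu v₂ hv₂ v hv u₂ hu₂
    refine ⟨⌊z * w * a⌋ - ⌊z * t'⌋ - ⌊z * u'⌋ + ⌊z * v'⌋ + ⌊z * t'⌋ + (t - t₂) + f,
      Finset.add_mem_add (Finset.add_mem_add (Finset.add_mem_add ?_
        (Finset.mem_image_of_mem _ ht')) (Finset.sub_mem_sub ht ht₂)) hf, x, hx, y, hy, ?_⟩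
    · have h1 := Int.floor_le (w * a)
      have h2 := Int.lt_floor_add_one (w * a)
      have h3 := Int.floor_le (z * w * a)
      have h4 := Int.lt_floor_add_one (z * w * a)
      have h5 := Int.floor_le (z * t')
      have h6 := Int.lt_floor_add_one (z * t')
      have h7 := Int.floor_le (z * u')
      have h8 := Int.lt_floor_add_one (z * u')
      have h9 := Int.floor_le (z * v')
      have h10 := Int.lt_floor_add_one (z * v')
      have e3 : (⌊w * a⌋ : ℝ) = t' + u' - v' := by exact_mod_cast e'
      have e4 : z * w * a = z * t' + z * u' - z * v' + z * (w * a - ⌊w * a⌋) := by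
        rw [e3]; ring
      have h11 : |z * (w * a - ⌊w * a⌋)| ≤ 4 := by
        rw [abs_mul, abs_of_nonneg (a := w * a - ⌊w * a⌋) (by linarith)]
        calc |z| * (w * a - ⌊w * a⌋) ≤ 4 * 1 := by
              apply mul_le_mul hz4 <;> linarith
          _ = 4 := by norm_num
      obtain ⟨h12, h13⟩ := abs_le.1 h11
      rw [Finset.mem_Icc]
      constructor
      · have : (-6 : ℝ) < ⌊z * w * a⌋ - ⌊z * t'⌋ - ⌊z * u'⌋ + ⌊z * v'⌋ := by linarith
        have h : (-6 : ℤ) < ⌊z * w * a⌋ - ⌊z * t'⌋ - ⌊z * u'⌋ + ⌊z * v'⌋ := by exact_mod_cast this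
        omega
      · have : ⌊z * w * a⌋ - ⌊z * t'⌋ - ⌊z * u'⌋ + ⌊z * v'⌋ < (6 : ℝ) := by linarith
        have h : ⌊z * w * a⌋ - ⌊z * t'⌋ - ⌊z * u'⌋ + ⌊z * v'⌋ < (6 : ℤ) := by exact_mod_cast this
        omega
    · rw [e, e₂]; linarith

lemma sumsetCovered_of_card_sub_le (hS : S.Nonempty) {K : ℝ} (h : ((S - S).card : ℝ) ≤ K * S.card) :
    SumsetCovered S (K ^ 5) := by
  have hS0 : (0 : ℝ) < S.card := by exact_mod_cast hS.card_pos
  have h1 := Finset.pluennecke_ruzsa_inequality_nsmul_sub_nsmul_sub hS S 3 2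
  have h1' : ((3 • S - 2 • S).card : ℝ) ≤ ((S - S).card / S.card : ℝ) ^ (3 + 2) * S.card := by
    have := (NNRat.cast_le (K := ℝ)).2 h1
    push_cast at this
    exact this
  have h2 : ((S - S).card / S.card : ℝ) ≤ K := by rwa [div_le_iff₀ hS0]
  have h3 : ((2 • S - 2 • S + S).card : ℝ) ≤ K ^ 5 * S.card := by
    have : 2 • S - 2 • S + S = 3 • S - 2 • S := by
      rw [succ_nsmul S 2, sub_eq_add_neg, sub_eq_add_neg, add_right_comm]
    rw [this]
    refine h1'.trans ?_
    gcongr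
  obtain ⟨F, -, hF, hsub⟩ := Finset.ruzsa_covering_add hS h3
  refine ⟨F, hF, fun u₁ hu₁ u₂ hu₂ v₁ hv₁ v₂ hv₂ ↦ ?_⟩
  have hm : u₁ + u₂ - (v₁ + v₂) ∈ 2 • S - 2 • S := by
    rw [two_nsmul]
    exact Finset.sub_mem_sub (Finset.add_mem_add hu₁ hu₂) (Finset.add_mem_add hv₁ hv₂)
  obtain ⟨f, hf, y, hy, e⟩ := Finset.mem_add.1 (hsub hm)
  obtain ⟨u, hu, v, hv, e'⟩ := Finset.mem_sub.1 hy
  exact ⟨f, hf, u, hu, v, hv, by linarith⟩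

lemma isMultiplier_of_card_add_le (hS : S.Nonempty) {K : ℝ}
    (h : ((S + S.image (fun a : ℤ ↦ ⌊z * a⌋)).card : ℝ) ≤ K * S.card) : IsMultiplier S K z := by
  rw [add_comm] at h
  obtain ⟨T, -, hT, hsub⟩ := Finset.ruzsa_covering_add hS h
  refine ⟨T, hT, fun a ha ↦ ?_⟩
  obtain ⟨f, hf, y, hy, e⟩ := Finset.mem_add.1 (hsub (Finset.mem_image_of_mem _ ha))
  obtain ⟨u, hu, v, hv, e'⟩ := Finset.mem_sub.1 hy
  exact ⟨f, hf, u, hu, v, hv, by linarith⟩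

/-- If `|S + ⌊z S⌋|` is small for some `z` that is not too small, then `S` has small doubling, by
Ruzsa's triangle inequality. -/
lemma card_sub_le_of_card_add_le {K : ℝ} (hz : 0 < z) (hz1 : z ≤ 1)
    (h : ((S + S.image (fun a : ℤ ↦ ⌊z * a⌋)).card : ℝ) ≤ K * S.card) :
    ((S - S).card : ℝ) ≤ 3 / z * K ^ 2 * S.card := by
  rcases S.eq_empty_or_nonempty with rfl | hS
  · simp
  have hS0 : (0 : ℝ) < S.card := by exact_mod_cast hS.card_pos
  set B := S.image (fun a : ℤ ↦ ⌊z * a⌋) with hB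
  have hB0 : (0 : ℝ) < B.card := by exact_mod_cast (hS.image _).card_pos
  have h1 : (S.card : ℝ) ≤ 3 / z * B.card := by
    refine card_le_mul_card_image_real S _ _ fun b _ ↦ ?_
    refine (card_le_of_injOn_floor (x := b / z) (ℓ := 1 / z) (r := 1) _ (fun a : ℤ ↦ (a : ℝ))
      one_pos (by positivity) (fun a _ b _ e ↦ by simpa using e) fun a ha ↦ ?_).trans ?_
    · obtain ⟨-, ha⟩ := Finset.mem_filter.1 ha
      obtain ⟨h3, h4⟩ := Int.floor_eq_iff.1 ha
      rw [← add_div, div_le_iff₀ hz, le_div_iff₀ hz]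
      constructor <;> linarith
    · have : 1 ≤ 1 / z := by rw [le_div_iff₀ hz]; linarith
      have e : 3 / z = 3 * (1 / z) := by ring
      rw [e]; linarith
  have h2 : ((S - S).card : ℝ) * B.card ≤ (S + B).card * (S + B).card := by
    exact_mod_cast Finset.ruzsa_triangle_inequality_sub_add_add S B S
  have h3 : ((S - S).card : ℝ) * B.card ≤ (K * S.card) * (K * S.card) :=
    h2.trans (mul_le_mul h h (by positivity) ((Nat.cast_nonneg _).trans h))
  have h4 : (K * S.card) * (K * S.card) ≤ 3 / z * K ^ 2 * S.card * B.card := by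
    calc (K * S.card) * (K * S.card) = K ^ 2 * S.card * S.card := by ring
      _ ≤ K ^ 2 * S.card * (3 / z * B.card) := by gcongr
      _ = _ := by ring
  exact le_of_mul_le_mul_right (h3.trans h4) hB0

lemma IsMultiplier.card_add_le (hS : S.Nonempty) (hF : SumsetCovered S L)
    (hd : ((S - S).card : ℝ) ≤ L * S.card) (h : IsMultiplier S L z) :
    ((S + S.image (fun a : ℤ ↦ ⌊z * a⌋)).card : ℝ) ≤ L ^ 3 * S.card := by
  obtain ⟨T, hT, h⟩ := h
  obtain ⟨F, hFc, hF⟩ := hF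
  obtain ⟨s, hs⟩ := hS
  have hsub : S + S.image (fun a : ℤ ↦ ⌊z * a⌋) ⊆ {s} + T + F + (S - S) := by
    intro x hx
    obtain ⟨a, ha, y, hy, rfl⟩ := Finset.mem_add.1 hx
    obtain ⟨b, hb, rfl⟩ := Finset.mem_image.1 hy
    obtain ⟨t, ht, u, hu, v, hv, e⟩ := h b hb
    obtain ⟨f, hf, u', hu', v', hv', e'⟩ := hF a ha u hu v hv s hs
    have : a + ⌊z * b⌋ = s + t + f + (u' - v') := by rw [e]; linarith
    rw [this]
    exact Finset.add_mem_add (Finset.add_mem_add (Finset.add_mem_add (by simp) ht) hf)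
      (Finset.sub_mem_sub hu' hv')
  calc ((S + S.image (fun a : ℤ ↦ ⌊z * a⌋)).card : ℝ) ≤ ({s} + T + F + (S - S)).card := by
        exact_mod_cast Finset.card_le_card hsub
    _ ≤ 1 * L * L * (L * S.card) :=
        card_add_le_mul (card_add_le_mul (card_add_le_mul (by simp) hT) hFc) hd
    _ = _ := by ring

end Multiplier

/-! ### Filtered rings of real numbers and their covering numbers -/

/-- An increasing sequence of sets of real numbers such that sums, differences and products of
bounded elements of one set lie in the next one. -/
structure IsFilteredRing (G : ℕ → Set ℝ) : Prop where
  subset_succ : ∀ i, G i ⊆ G (i + 1)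
  one_mem : 1 ∈ G 0
  neg_mem : ∀ i, ∀ z ∈ G i, -z ∈ G (i + 1)
  add_mem : ∀ i, ∀ z ∈ G i, ∀ w ∈ G i, z + w ∈ G (i + 1)
  mul_mem : ∀ i, ∀ z ∈ G i, ∀ w ∈ G i, |z| ≤ 4 → z * w ∈ G (i + 1)

/-- The number of cells `[k r, (k + 1) r)`, with `k` an integer, that meet `G ∩ [-R, R]`. -/
noncomputable def cellCount (G : Set ℝ) (r R : ℝ) : ℕ :=
  ((fun g : ℝ ↦ ⌊g / r⌋) '' (G ∩ Set.Icc (-R) R)).ncard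

section CellCount

variable {G H : Set ℝ} {r r' R R' : ℝ}

lemma floor_div_eq_iff {x : ℝ} {k : ℤ} (hr : 0 < r) :
    ⌊x / r⌋ = k ↔ k * r ≤ x ∧ x < k * r + r := by
  rw [Int.floor_eq_iff, le_div_iff₀ hr, div_lt_iff₀ hr, add_mul, one_mul]

lemma finite_cells (hr : 0 < r) :
    ((fun g : ℝ ↦ ⌊g / r⌋) '' (G ∩ Set.Icc (-R) R)).Finite := by
  refine (Set.finite_Icc ⌊-R / r⌋ ⌊R / r⌋).subset ?_
  rintro _ ⟨g, ⟨-, h1, h2⟩, rfl⟩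
  exact ⟨Int.floor_le_floor (by gcongr), Int.floor_le_floor (by gcongr)⟩

/-- A choice of one point of `G ∩ [-R, R]` in each cell that it meets. -/
lemma exists_cell_representatives (G : Set ℝ) (hr : 0 < r) (R : ℝ) :
    ∃ P : Finset ℝ, (∀ p ∈ P, p ∈ G ∧ |p| ≤ R) ∧
      Set.InjOn (fun g : ℝ ↦ ⌊g / r⌋) (P : Set ℝ) ∧ P.card = cellCount G r R := by
  obtain ⟨u, hu, hbij⟩ := Set.exists_subset_bijOn (G ∩ Set.Icc (-R) R) (fun g : ℝ ↦ ⌊g / r⌋)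
  have hfin : u.Finite := by
    refine Set.Finite.of_finite_image ?_ hbij.injOn
    rw [hbij.image_eq]
    exact finite_cells hr
  refine ⟨hfin.toFinset, fun p hp ↦ ?_, by simpa using hbij.injOn, ?_⟩
  · have := hu (hfin.mem_toFinset.1 hp)
    exact ⟨this.1, abs_le.2 this.2⟩
  · rw [← Set.ncard_eq_toFinset_card u hfin, cellCount, ← hbij.image_eq,
      hbij.injOn.ncard_image]

lemma card_le_mul_cellCount {ι : Type*} (s : Finset ι) (f : ι → ℝ) (hr : 0 < r) {m : ℝ}
    (hf : ∀ i ∈ s, f i ∈ G ∧ |f i| ≤ R)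
    (h : ∀ k : ℤ, ((s.filter (fun i ↦ ⌊f i / r⌋ = k)).card : ℝ) ≤ m) :
    (s.card : ℝ) ≤ m * cellCount G r R := by
  classical
  refine (card_le_mul_card_image_real s (fun i ↦ ⌊f i / r⌋) m fun k _ ↦ h k).trans ?_
  have hm : 0 ≤ m := (Nat.cast_nonneg _).trans (h 0)
  gcongr
  rw [cellCount, ← Set.ncard_coe_finset]
  refine Set.ncard_le_ncard ?_ (finite_cells hr)
  intro k hk
  obtain ⟨i, hi, rfl⟩ := Finset.mem_image.1 (Finset.mem_coe.1 hk)
  exact ⟨f i, ⟨(hf i hi).1, abs_le.1 (hf i hi).2⟩, rfl⟩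

lemma cellCount_mono (hr : 0 < r) (hG : G ⊆ H) (hR : R ≤ R') :
    cellCount G r R ≤ cellCount H r R' := by
  refine Set.ncard_le_ncard ?_ (finite_cells hr)
  exact Set.image_mono (Set.inter_subset_inter hG (Set.Icc_subset_Icc (by linarith) hR))

lemma cellCount_le (hr : 0 < r) (hR : 0 ≤ R) : (cellCount G r R : ℝ) ≤ 2 * R / r + 2 := by
  obtain ⟨P, hP, hinj, hcard⟩ := exists_cell_representatives G hr R
  rw [← hcard]
  refine card_le_of_injOn_floor P id (x := -R) hr (by linarith) hinj fun p hp ↦ ?_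
  have := abs_le.1 (hP p hp).2
  simp only [id]
  constructor <;> linarith

lemma card_filter_floor_le {ι : Type*} (s : Finset ι) (f g : ι → ℝ) (hr : 0 < r) (hr' : 0 < r')
    (c : ℝ) (hfg : ∀ i ∈ s, g i = f i + c) (hinj : Set.InjOn (fun i ↦ ⌊f i / r⌋) (s : Set ι))
    (k : ℤ) : ((s.filter (fun i ↦ ⌊g i / r'⌋ = k)).card : ℝ) ≤ r' / r + 2 := by
  refine card_le_of_injOn_floor _ f (x := k * r' - c) hr hr'.le
    (hinj.mono (Finset.coe_subset.2 (Finset.filter_subset _ _))) fun i hi ↦ ?_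
  obtain ⟨hi, e⟩ := Finset.mem_filter.1 hi
  rw [floor_div_eq_iff hr', hfg i hi] at e
  constructor <;> linarith

end CellCount

namespace IsFilteredRing

variable {G : ℕ → Set ℝ} {r R : ℝ} {i j : ℕ}

lemma mono (hG : IsFilteredRing G) (h : i ≤ j) : G i ⊆ G j :=
  monotone_nat_of_le_succ hG.subset_succ h

lemma shift (hG : IsFilteredRing G) (k : ℕ) : IsFilteredRing fun i ↦ G (k + i) where
  subset_succ i := hG.subset_succ (k + i)
  one_mem := hG.mono (Nat.zero_le _) hG.one_mem
  neg_mem i := hG.neg_mem (k + i)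
  add_mem i := hG.add_mem (k + i)
  mul_mem i := hG.mul_mem (k + i)

lemma sub_mem (hG : IsFilteredRing G) {z w : ℝ} (hz : z ∈ G i) (hw : w ∈ G i) :
    z - w ∈ G (i + 2) := by
  rw [sub_eq_add_neg]
  exact hG.add_mem _ _ (hG.subset_succ _ hz) _ (hG.neg_mem _ _ hw)

/-- Cells of `G i` in an interval of length `ℓ` are translated to the origin. -/
lemma card_le_cellCount (hG : IsFilteredRing G) (hr : 0 < r) (P : Finset ℝ) {x ℓ : ℝ}
    (hP : ∀ p ∈ P, p ∈ G i ∧ x ≤ p ∧ p ≤ x + ℓ)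
    (hinj : Set.InjOn (fun g : ℝ ↦ ⌊g / r⌋) (P : Set ℝ)) :
    (P.card : ℝ) ≤ 3 * cellCount (G (i + 2)) r ℓ := by
  rcases P.eq_empty_or_nonempty with rfl | ⟨p₀, hp₀⟩
  · simp
  refine card_le_mul_cellCount P (fun p ↦ p - p₀) hr (fun p hp ↦ ?_) fun k ↦ ?_
  · obtain ⟨h1, h2, h3⟩ := hP p hp
    obtain ⟨h4, h5, h6⟩ := hP p₀ hp₀
    exact ⟨hG.sub_mem h1 h4, abs_le.2 ⟨by linarith, by linarith⟩⟩
  · refine (card_filter_floor_le P id _ hr hr (-p₀) (fun p _ ↦ rfl) hinj k).trans ?_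
    rw [div_self hr.ne']; norm_num

lemma cellCount_eight_mul_le (hG : IsFilteredRing G) (hr : 0 < r) (hR : 0 < R) :
    (cellCount (G i) r (8 * R) : ℝ) ≤ 51 * cellCount (G (i + 2)) r R := by
  classical
  obtain ⟨P, hP, hinj, hcard⟩ := exists_cell_representatives (G i) hr (8 * R)
  rw [← hcard]
  refine (card_le_mul_card_image_real P (fun p ↦ ⌊p / R⌋) (3 * cellCount (G (i + 2)) r R)
    fun k _ ↦ ?_).trans ?_
  · refine hG.card_le_cellCount hr _ (x := k * R) (fun p hp ↦ ?_)
      (hinj.mono (Finset.coe_subset.2 (Finset.filter_subset _ _)))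
    obtain ⟨hp, e⟩ := Finset.mem_filter.1 hp
    rw [floor_div_eq_iff hR] at e
    exact ⟨(hP p hp).1, e.1, e.2.le⟩
  · have h1 : P.image (fun p ↦ ⌊p / R⌋) ⊆ Finset.Icc (-8) 8 := by
      intro k hk
      obtain ⟨p, hp, rfl⟩ := Finset.mem_image.1 hk
      obtain ⟨h1, h2⟩ := abs_le.1 (hP p hp).2
      rw [Finset.mem_Icc, Int.le_floor, ← Int.lt_add_one_iff, Int.floor_lt]
      rw [le_div_iff₀ hR, div_lt_iff₀ hR]
      push_cast
      constructor <;> linarith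
    have h2 : ((P.image (fun p ↦ ⌊p / R⌋)).card : ℝ) ≤ 17 := by
      exact_mod_cast (Finset.card_le_card h1).trans_eq (by simp)
    calc 3 * (cellCount (G (i + 2)) r R : ℝ) * (P.image (fun p ↦ ⌊p / R⌋)).card
        ≤ 3 * (cellCount (G (i + 2)) r R : ℝ) * 17 := by gcongr
      _ = _ := by ring

/-- Adding elements of size at most `R` to `R`-separated elements. -/
lemma cellCount_mul_cellCount_le (hG : IsFilteredRing G) (hr : 0 < r) (hrR : r ≤ R) (hR1 : R ≤ 1) :
    (cellCount (G i) R 1 : ℝ) * cellCount (G i) r R ≤ 765 * cellCount (G (i + 3)) r 1 := by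
  classical
  have hR : 0 < R := hr.trans_le hrR
  obtain ⟨P, hP, hPinj, hPcard⟩ := exists_cell_representatives (G i) hR 1
  obtain ⟨Q, hQ, hQinj, hQcard⟩ := exists_cell_representatives (G i) hr R
  have h1 : ((P ×ˢ Q).card : ℝ) ≤ (3 * 5) * cellCount (G (i + 1)) r (8 * 1) := by
    refine card_le_mul_cellCount _ (fun x : ℝ × ℝ ↦ x.1 + x.2) hr (fun x hx ↦ ?_) fun k ↦ ?_
    · obtain ⟨hx1, hx2⟩ := Finset.mem_product.1 hx
      refine ⟨hG.add_mem _ _ (hP _ hx1).1 _ (hQ _ hx2).1, (abs_add_le _ _).trans ?_⟩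
      linarith [(hP _ hx1).2, (hQ _ hx2).2]
    · refine (card_le_mul_card_image_real _ (fun x : ℝ × ℝ ↦ x.1) 3 fun p _ ↦ ?_).trans ?_
      · have hle := card_le_of_injOn_floor (r := r) (x := k * r - p) (ℓ := r)
          (((P ×ˢ Q).filter (fun x ↦ ⌊(x.1 + x.2) / r⌋ = k)).filter (fun x ↦ x.1 = p))
          (fun x : ℝ × ℝ ↦ x.2) hr hr.le ?_ ?_
        · rw [div_self hr.ne'] at hle
          linarith
        · rintro ⟨a, b⟩ hx ⟨a', b'⟩ hx' e
          simp only [Finset.coe_filter, Finset.mem_filter, Finset.mem_product, Set.mem_ofPred_eq]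
            at hx hx'
          have := hQinj hx.1.1.2 hx'.1.1.2 e
          simp only [Prod.mk.injEq]
          exact ⟨hx.2.trans hx'.2.symm, this⟩
        · rintro ⟨a, b⟩ hx
          simp only [Finset.mem_filter, Finset.mem_product, floor_div_eq_iff hr] at hx
          obtain ⟨⟨-, h1, h2⟩, rfl⟩ := hx
          constructor <;> dsimp only <;> linarith
      · gcongr
        refine (card_le_of_injOn_floor (r := R) (x := k * r - R) (ℓ := 3 * R) _ id hR
          (by linarith) (hPinj.mono ?_) ?_).trans_eq ?_
        · intro p hp
          simp only [Finset.coe_image, Set.mem_image, Finset.mem_coe, Finset.mem_filter,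
            Finset.mem_product] at hp
          obtain ⟨x, hx, rfl⟩ := hp
          exact hx.1.1
        · intro p hp
          obtain ⟨x, hx, rfl⟩ := Finset.mem_image.1 hp
          simp only [Finset.mem_filter, Finset.mem_product, floor_div_eq_iff hr] at hx
          obtain ⟨⟨h0, h3⟩, h1, h2⟩ := hx
          obtain ⟨h4, h5⟩ := abs_le.1 (hQ _ h3).2
          simp only [id]
          constructor <;> linarith
        · rw [mul_div_assoc, div_self hR.ne']; norm_num
  rw [Finset.card_product] at h1
  have h2 := hG.cellCount_eight_mul_le (i := i + 1) hr one_pos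
  calc (cellCount (G i) R 1 : ℝ) * cellCount (G i) r R = ((P.card * Q.card : ℕ) : ℝ) := by
        rw [hPcard, hQcard]; push_cast; ring
    _ ≤ (3 * 5) * cellCount (G (i + 1)) r (8 * 1) := h1
    _ ≤ (3 * 5) * (51 * cellCount (G (i + 1 + 2)) r 1) := by gcongr
    _ = _ := by rw [show i + 1 + 2 = i + 3 by ring]; ring

end IsFilteredRing

/-! ### Collisions of the maps `(p, q) ↦ p + z q` -/

section Collisions

open Classical in
/-- The number of pairs of pairs `(p, q)`, `(p', q')` for which `p + z q` and `p' + z q'` lie in the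
same cell of length `ρ`. -/
noncomputable def collisions (P : Finset ℝ) (ρ z : ℝ) : ℕ :=
  (((P ×ˢ P) ×ˢ (P ×ˢ P)).filter fun x ↦
    ⌊(x.1.1 + z * x.1.2) / ρ⌋ = ⌊(x.2.1 + z * x.2.2) / ρ⌋).card

open Classical in
/-- The number of pairs of points of `P` at distance less than `D`. -/
noncomputable def closePairs (P : Finset ℝ) (D : ℝ) : ℕ :=
  ((P ×ˢ P).filter fun x ↦ |x.1 - x.2| < D).card

open Classical in
/-- The number of near collisions of `(p, q) ↦ p + z q` whose second coordinates are at distance at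
least `D`. -/
noncomputable def farCollisions (P : Finset ℝ) (ρ D z : ℝ) : ℕ :=
  (((P ×ˢ P) ×ˢ (P ×ˢ P)).filter fun x ↦
    D ≤ |x.1.2 - x.2.2| ∧ |x.1.1 - x.2.1 + z * (x.1.2 - x.2.2)| < ρ).card

variable {P : Finset ℝ} {ρ D : ℝ}

/-- Cauchy–Schwarz: a map with few collisions has a large image. -/
lemma card_pow_four_le (P : Finset ℝ) (ρ z : ℝ) :
    (P.card : ℝ) ^ 4 ≤
      ((P ×ˢ P).image fun x ↦ ⌊(x.1 + z * x.2) / ρ⌋).card * collisions P ρ z := by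
  classical
  set f : ℝ × ℝ → ℤ := fun x ↦ ⌊(x.1 + z * x.2) / ρ⌋ with hf
  set s := P ×ˢ P with hs
  have h1 : s.card = ∑ k ∈ s.image f, (s.filter fun x ↦ f x = k).card :=
    Finset.card_eq_sum_card_image f s
  have h2 : collisions P ρ z = ∑ k ∈ s.image f, (s.filter fun x ↦ f x = k).card ^ 2 := by
    have : ∀ x ∈ (s ×ˢ s).filter (fun x ↦ f x.1 = f x.2), f x.1 ∈ s.image f := fun x hx ↦
      Finset.mem_image_of_mem _ (Finset.mem_product.1 (Finset.mem_filter.1 hx).1).1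
    unfold collisions
    rw [Finset.card_eq_sum_card_fiberwise this]
    refine Finset.sum_congr rfl fun k _ ↦ ?_
    rw [pow_two, ← Finset.card_product]
    congr 1
    ext x
    simp only [Finset.mem_filter, Finset.mem_product]
    constructor
    · rintro ⟨⟨⟨h1, h2⟩, h3⟩, rfl⟩
      exact ⟨⟨h1, rfl⟩, h2, h3.symm⟩
    · rintro ⟨⟨h1, rfl⟩, h2, h3⟩
      exact ⟨⟨⟨h1, h2⟩, h3.symm⟩, rfl⟩
  have h3 := sq_sum_le_card_mul_sum_sq (s := s.image f)
    (f := fun k ↦ ((s.filter fun x ↦ f x = k).card : ℝ))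
  have h4 : (s.card : ℝ) = (P.card : ℝ) ^ 2 := by rw [hs, Finset.card_product]; push_cast; ring
  calc (P.card : ℝ) ^ 4 = (s.card : ℝ) ^ 2 := by rw [h4]; ring
    _ = (∑ k ∈ s.image f, ((s.filter fun x ↦ f x = k).card : ℝ)) ^ 2 := by
        rw [h1]; push_cast; rfl
    _ ≤ _ := h3
    _ = _ := by rw [h2]; push_cast; rfl

lemma collisions_le (hρ : 0 < ρ) (hinj : Set.InjOn (fun g : ℝ ↦ ⌊g / ρ⌋) (P : Set ℝ)) (D z : ℝ) :
    (collisions P ρ z : ℝ) ≤ 4 * (P.card * closePairs P D) + farCollisions P ρ D z := by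
  classical
  set s := (P ×ˢ P) ×ˢ (P ×ˢ P) with hs
  set c := s.filter fun x ↦ |x.1.2 - x.2.2| < D ∧
    |x.1.1 - x.2.1 + z * (x.1.2 - x.2.2)| < ρ with hc
  have h1 : collisions P ρ z ≤ c.card + farCollisions P ρ D z := by
    refine (Finset.card_le_card ?_).trans (Finset.card_union_le c _)
    intro x hx
    obtain ⟨hx, e⟩ := Finset.mem_filter.1 hx
    have h3 : |x.1.1 - x.2.1 + z * (x.1.2 - x.2.2)| < ρ := by
      have := Int.abs_sub_lt_one_of_floor_eq_floor e
      rw [← sub_div, abs_div, abs_of_pos hρ, div_lt_one hρ] at this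
      have e' : x.1.1 - x.2.1 + z * (x.1.2 - x.2.2) =
          x.1.1 + z * x.1.2 - (x.2.1 + z * x.2.2) := by ring
      rwa [e']
    rw [Finset.mem_union]
    rcases lt_or_ge (|x.1.2 - x.2.2|) D with h | h
    · exact Or.inl (Finset.mem_filter.2 ⟨hx, h, h3⟩)
    · exact Or.inr (Finset.mem_filter.2 ⟨hx, h, h3⟩)
  have h2 : (c.card : ℝ) ≤ 4 * (P.card * closePairs P D) := by
    refine (card_le_mul_card_image_real c (fun x ↦ (x.1.1, (x.1.2, x.2.2))) 4
      fun y _ ↦ ?_).trans ?_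
    · refine (card_le_of_injOn_floor _ (fun x : (ℝ × ℝ) × (ℝ × ℝ) ↦ x.2.1) (r := ρ)
        (x := y.1 + z * (y.2.1 - y.2.2) - ρ) (ℓ := 2 * ρ) hρ (by linarith) ?_ ?_).trans_eq ?_
      · rintro ⟨⟨a, b⟩, a', b'⟩ hx ⟨⟨a₂, b₂⟩, a₂', b₂'⟩ hx₂ e
        simp only [hc, hs, Finset.coe_filter, Finset.mem_filter, Finset.mem_product,
          Set.mem_ofPred_eq] at hx hx₂
        have e1 := hinj hx.1.1.2.1 hx₂.1.1.2.1 e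
        have e2 := hx.2.trans hx₂.2.symm
        simp only [Prod.mk.injEq] at e2 ⊢
        exact ⟨⟨e2.1, e2.2.1⟩, e1, e2.2.2⟩
      · rintro ⟨⟨a, b⟩, a', b'⟩ hx
        simp only [hc, Finset.mem_filter] at hx
        obtain ⟨⟨-, -, h⟩, rfl⟩ := hx
        obtain ⟨h3, h4⟩ := abs_lt.1 h
        constructor <;> dsimp only at * <;> linarith
      · rw [mul_div_assoc, div_self hρ.ne']; norm_num
    · gcongr
      rw [closePairs, ← Nat.cast_mul, ← Finset.card_product]
      gcongr
      intro y hy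
      obtain ⟨x, hx, rfl⟩ := Finset.mem_image.1 hy
      simp only [hc, hs, Finset.mem_filter, Finset.mem_product] at hx ⊢
      tauto
  have h1' : (collisions P ρ z : ℝ) ≤ c.card + farCollisions P ρ D z := by exact_mod_cast h1
  linarith

lemma sum_farCollisions_le (P Z : Finset ℝ) (hD : 0 < D) {m : ℝ} (hρ : 0 < ρ)
    (hZ : ∀ Z' ⊆ Z, ∀ x : ℝ, (∀ z ∈ Z', |z - x| < ρ / D) → (Z'.card : ℝ) ≤ m) :
    (∑ z ∈ Z, farCollisions P ρ D z : ℝ) ≤ m * (P.card : ℝ) ^ 4 := by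
  classical
  set s := (P ×ˢ P) ×ˢ (P ×ˢ P) with hs
  have hm : 0 ≤ m := by simpa using hZ ∅ (by simp) 0 (by simp)
  have h1 : ∑ z ∈ Z, farCollisions P ρ D z =
      ∑ x ∈ s, (Z.filter fun z ↦ D ≤ |x.1.2 - x.2.2| ∧
        |x.1.1 - x.2.1 + z * (x.1.2 - x.2.2)| < ρ).card :=
    Finset.sum_card_bipartiteAbove_eq_sum_card_bipartiteBelow
      (fun (z : ℝ) (x : (ℝ × ℝ) × (ℝ × ℝ)) ↦ D ≤ |x.1.2 - x.2.2| ∧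
        |x.1.1 - x.2.1 + z * (x.1.2 - x.2.2)| < ρ)
  rw [← Nat.cast_sum, h1, Nat.cast_sum]
  calc _ ≤ ∑ x ∈ s, m := by
        refine Finset.sum_le_sum fun x _ ↦ ?_
        refine hZ _ (Finset.filter_subset _ _) (-(x.1.1 - x.2.1) / (x.1.2 - x.2.2)) fun z hz ↦ ?_
        obtain ⟨-, h2, h3⟩ := Finset.mem_filter.1 hz
        have h4 : 0 < |x.1.2 - x.2.2| := hD.trans_le h2
        have h5 : x.1.2 - x.2.2 ≠ 0 := abs_pos.1 h4
        have h6 : z - -(x.1.1 - x.2.1) / (x.1.2 - x.2.2) =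
            (x.1.1 - x.2.1 + z * (x.1.2 - x.2.2)) / (x.1.2 - x.2.2) := by
          field_simp; ring
        rw [h6, abs_div]
        calc _ < ρ / |x.1.2 - x.2.2| := by gcongr
          _ ≤ ρ / D := by gcongr
    _ = m * (P.card : ℝ) ^ 4 := by
        rw [Finset.sum_const, nsmul_eq_mul, hs]
        simp only [Finset.card_product]
        push_cast
        ring

end Collisions

/-- A set that is almost invariant under `b ↦ b / 2` and `b ↦ (b + 1) / 2` is dense in `[0, 1]`. -/
lemma exists_near_of_halving {B : Set ℝ} {s : ℝ} (hs0 : 0 < s) (hs4 : s ≤ 1 / 4) (h0 : (0 : ℝ) ∈ B)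
    (h : ∀ b ∈ B, -1 ≤ b → b ≤ 2 →
      (∃ b' ∈ B, |b' - b / 2| ≤ s) ∧ ∃ b' ∈ B, |b' - (b + 1) / 2| ≤ s)
    {y : ℝ} (hy : y ∈ Set.Icc (0 : ℝ) 1) : ∃ b ∈ B, |b - y| ≤ 3 * s := by
  have key : ∀ k : ℕ, ∀ y ∈ Set.Icc (0 : ℝ) 1,
      ∃ b ∈ B, -1 ≤ b ∧ b ≤ 2 ∧ |b - y| ≤ (1 / 2) ^ k + 2 * s := by
    intro k
    induction k with
    | zero =>
      intro y hy
      refine ⟨0, h0, by norm_num, by norm_num, ?_⟩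
      rw [zero_sub, abs_neg, abs_of_nonneg hy.1]
      linarith [hy.2]
    | succ k ih =>
      intro y hy
      have hk : (1 / 2 : ℝ) ^ (k + 1) = (1 / 2) ^ k / 2 := by rw [pow_succ]; ring
      have hk1 : (1 / 2 : ℝ) ^ k ≤ 1 := pow_le_one₀ (by norm_num) (by norm_num)
      rcases le_total y (1 / 2) with hy2 | hy2
      · obtain ⟨b, hb, hb1, hb2, hby⟩ := ih (2 * y) ⟨by linarith [hy.1], by linarith⟩
        obtain ⟨b', hb', hbb⟩ := (h b hb hb1 hb2).1
        have h1 := abs_le.1 hby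
        have h2 := abs_le.1 hbb
        refine ⟨b', hb', ?_, ?_, abs_le.2 ⟨?_, ?_⟩⟩ <;> rw [Set.mem_Icc] at hy <;> linarith
      · obtain ⟨b, hb, hb1, hb2, hby⟩ := ih (2 * y - 1) ⟨by linarith, by linarith [hy.2]⟩
        obtain ⟨b', hb', hbb⟩ := (h b hb hb1 hb2).2
        have h1 := abs_le.1 hby
        have h2 := abs_le.1 hbb
        refine ⟨b', hb', ?_, ?_, abs_le.2 ⟨?_, ?_⟩⟩ <;> rw [Set.mem_Icc] at hy <;> linarith
  obtain ⟨k, hk⟩ := exists_pow_lt_of_lt_one hs0 (by norm_num : (1 / 2 : ℝ) < 1)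
  obtain ⟨b, hb, -, -, h⟩ := key k y hy
  exact ⟨b, hb, by linarith⟩

/-! ### Growth of covering numbers of a stable filtered ring -/

/-- A filtered ring whose covering numbers at the scales `lam ^ j`, `j ≤ J`, do not change by more
than a factor `lam⁻¹` along the first twenty steps of the filtration, and which has elements of
every size between `lam ^ J` and `1`, up to a factor `lam ^ c`. -/
structure IsStableRing (G : ℕ → Set ℝ) (lam : ℝ) (J c : ℕ) : Prop extends IsFilteredRing G where
  pos : 0 < lam
  le_small : lam ≤ 1 / 1000
  stable : ∀ j ≤ J, (cellCount (G 20) (lam ^ j) 1 : ℝ) ≤ lam⁻¹ * cellCount (G 0) (lam ^ j) 1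
  exists_mem : ∀ y, lam ^ J ≤ y → y ≤ 1 → ∃ w ∈ G 0, lam ^ c * y ≤ w ∧ w ≤ y

namespace IsStableRing

variable {G : ℕ → Set ℝ} {lam : ℝ} {J c a b : ℕ}

lemma le_inv (hG : IsStableRing G lam J c) : 1000 ≤ lam⁻¹ := by
  rw [le_inv_comm₀ (by norm_num) hG.pos]
  linarith [hG.le_small]

lemma pow_le_one' (hG : IsStableRing G lam J c) (n : ℕ) : lam ^ n ≤ 1 :=
  pow_le_one₀ hG.pos.le (by linarith [hG.le_small])

lemma one_le_inv_pow (hG : IsStableRing G lam J c) (n : ℕ) : 1 ≤ lam⁻¹ ^ n :=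
  one_le_pow₀ (by linarith [hG.le_inv])

lemma const_le (hG : IsStableRing G lam J c) {x : ℝ} (hx : x ≤ 1000000) : x ≤ lam⁻¹ ^ 2 := by
  have := hG.le_inv
  nlinarith

/-- Covering numbers of the elements of size at most `lam ^ a`. -/
lemma cellCount_mul_le (hG : IsStableRing G lam J c) (hab : a + b ≤ J) {i : ℕ} (hi : i ≤ 17) :
    (cellCount (G 0) (lam ^ a) 1 : ℝ) * cellCount (G i) (lam ^ (a + b)) (lam ^ a) ≤
      765 * lam⁻¹ * cellCount (G 0) (lam ^ (a + b)) 1 := by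
  have h0 : ∀ n : ℕ, 0 < lam ^ n := fun n ↦ pow_pos hG.pos n
  have hle : lam ^ (a + b) ≤ lam ^ a := by
    rw [pow_add]; exact mul_le_of_le_one_right (h0 a).le (hG.pow_le_one' b)
  calc (cellCount (G 0) (lam ^ a) 1 : ℝ) * cellCount (G i) (lam ^ (a + b)) (lam ^ a)
      ≤ cellCount (G i) (lam ^ a) 1 * cellCount (G i) (lam ^ (a + b)) (lam ^ a) := by
        gcongr
        exact cellCount_mono (h0 a) (hG.mono (Nat.zero_le i)) le_rfl
    _ ≤ 765 * cellCount (G (i + 3)) (lam ^ (a + b)) 1 :=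
        hG.cellCount_mul_cellCount_le (h0 _) hle (hG.pow_le_one' a)
    _ ≤ 765 * cellCount (G 20) (lam ^ (a + b)) 1 := by
        gcongr
        exact cellCount_mono (h0 _) (hG.mono (by omega)) le_rfl
    _ ≤ 765 * (lam⁻¹ * cellCount (G 0) (lam ^ (a + b)) 1) := by
        gcongr
        exact hG.stable _ hab
    _ = _ := by ring

/-- The logarithms of the covering numbers are superadditive up to a constant. -/
lemma mul_le_cellCount_add (hG : IsStableRing G lam J c) (hab : a + b ≤ J) :
    (cellCount (G 0) (lam ^ a) 1 : ℝ) * cellCount (G 0) (lam ^ b) 1 ≤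
      lam⁻¹ ^ (c + 7) * cellCount (G 0) (lam ^ (a + b)) 1 := by
  have h0 : ∀ n : ℕ, 0 < lam ^ n := fun n ↦ pow_pos hG.pos n
  obtain ⟨w, hw, hw1, hw2⟩ := hG.exists_mem (lam ^ a)
    (pow_le_pow_of_le_one hG.pos.le (by linarith [hG.le_small]) (by omega)) (hG.pow_le_one' a)
  have hw0 : 0 < w := (mul_pos (h0 _) (h0 _)).trans_le hw1
  obtain ⟨P, hP, hinj, hcard⟩ := exists_cell_representatives (G 0) (h0 b) 1
  have h1 : (P.card : ℝ) ≤ 3 * lam⁻¹ ^ c * cellCount (G 1) (lam ^ (a + b)) (lam ^ a) := by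
    refine card_le_mul_cellCount P (fun p ↦ w * p) (h0 _) (fun p hp ↦ ⟨?_, ?_⟩) fun k ↦ ?_
    · refine hG.mul_mem 0 w hw p (hP p hp).1 ?_
      rw [abs_of_pos hw0]
      linarith [hG.pow_le_one' a]
    · rw [abs_mul, abs_of_pos hw0, ← mul_one (lam ^ a)]
      exact mul_le_mul hw2 (hP p hp).2 (abs_nonneg _) (h0 a).le
    · refine (card_le_of_injOn_floor _ id (r := lam ^ b) (x := k * lam ^ (a + b) / w)
        (ℓ := lam ^ (a + b) / w) (h0 b) (div_pos (h0 _) hw0).le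
        (hinj.mono (Finset.coe_subset.2 (Finset.filter_subset _ _))) fun p hp ↦ ?_).trans ?_
      · obtain ⟨-, e⟩ := Finset.mem_filter.1 hp
        rw [floor_div_eq_iff (h0 _)] at e
        rw [← add_div, div_le_iff₀ hw0, le_div_iff₀ hw0]
        simp only [id]
        constructor <;> linarith
      · have h2 : lam ^ (a + b) / w / lam ^ b ≤ lam⁻¹ ^ c := by
          rw [div_div, div_le_iff₀ (mul_pos hw0 (h0 b)), inv_pow, inv_mul_eq_div, le_div_iff₀ (h0 c),
            pow_add]
          calc lam ^ a * lam ^ b * lam ^ c = (lam ^ c * lam ^ a) * lam ^ b := by ring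
            _ ≤ w * lam ^ b := mul_le_mul_of_nonneg_right hw1 (h0 b).le
        linarith [hG.one_le_inv_pow c]
  rw [hcard] at h1
  have h2 := hG.cellCount_mul_le hab (i := 1) (by norm_num)
  calc (cellCount (G 0) (lam ^ a) 1 : ℝ) * cellCount (G 0) (lam ^ b) 1
      ≤ cellCount (G 0) (lam ^ a) 1 *
        (3 * lam⁻¹ ^ c * cellCount (G 1) (lam ^ (a + b)) (lam ^ a)) := by gcongr
    _ = 3 * lam⁻¹ ^ c * (cellCount (G 0) (lam ^ a) 1 *
        cellCount (G 1) (lam ^ (a + b)) (lam ^ a)) := by ring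
    _ ≤ 3 * lam⁻¹ ^ c * (765 * lam⁻¹ * cellCount (G 0) (lam ^ (a + b)) 1) := by
        have := hG.one_le_inv_pow c
        gcongr
    _ = 2295 * (lam⁻¹ ^ (c + 1) * cellCount (G 0) (lam ^ (a + b)) 1) := by ring
    _ ≤ lam⁻¹ ^ 6 * (lam⁻¹ ^ (c + 1) * cellCount (G 0) (lam ^ (a + b)) 1) := by
        have := hG.one_le_inv_pow (c + 1)
        gcongr
        exact (hG.const_le (by norm_num)).trans
          (pow_le_pow_right₀ (by linarith [hG.le_inv]) (by norm_num))
    _ = _ := by ring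

lemma closePairs_mul_le (hG : IsStableRing G lam J c) (hab : a ≤ b) (hb : b ≤ J) {P : Finset ℝ}
    (hP : ∀ p ∈ P, p ∈ G 0 ∧ |p| ≤ 1)
    (hinj : Set.InjOn (fun g : ℝ ↦ ⌊g / lam ^ b⌋) (P : Set ℝ))
    (hcard : P.card = cellCount (G 0) (lam ^ b) 1) :
    (closePairs P (lam ^ a) : ℝ) * cellCount (G 0) (lam ^ a) 1 ≤ lam⁻¹ ^ 3 * (P.card : ℝ) ^ 2 := by
  classical
  have h0 : ∀ n : ℕ, 0 < lam ^ n := fun n ↦ pow_pos hG.pos n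
  set m : ℝ := 3 * (51 * cellCount (G 4) (lam ^ b) (lam ^ a)) with hm
  have h1 : (closePairs P (lam ^ a) : ℝ) ≤ m * P.card := by
    refine (card_le_mul_card_image_real _ (fun x : ℝ × ℝ ↦ x.1) m fun p _ ↦ ?_).trans ?_
    · set s := ((P ×ˢ P).filter fun x ↦ |x.1 - x.2| < lam ^ a).filter (fun x ↦ x.1 = p) with hs
      have hs' : ∀ x ∈ s, x.2 ∈ P ∧ |p - x.2| < lam ^ a ∧ x.1 = p := by
        intro x hx
        simp only [hs, Finset.mem_filter, Finset.mem_product] at hx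
        obtain ⟨⟨⟨-, h1⟩, h2⟩, rfl⟩ := hx
        exact ⟨h1, h2, rfl⟩
      have hsi : Set.InjOn Prod.snd (s : Set (ℝ × ℝ)) := fun x hx y hy e ↦
        Prod.ext ((hs' x hx).2.2.trans (hs' y hy).2.2.symm) e
      rw [← Finset.card_image_of_injOn hsi]
      refine (hG.card_le_cellCount (i := 0) (h0 b) _ (x := p - lam ^ a) (ℓ := 2 * lam ^ a)
        (fun q hq ↦ ?_) (hinj.mono fun q hq ↦ ?_)).trans ?_
      · obtain ⟨x, hx, rfl⟩ := Finset.mem_image.1 hq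
        obtain ⟨h1, h2, -⟩ := hs' x hx
        obtain ⟨h3, h4⟩ := abs_lt.1 h2
        exact ⟨(hP _ h1).1, by linarith, by linarith⟩
      · obtain ⟨x, hx, rfl⟩ := Finset.mem_image.1 (Finset.mem_coe.1 hq)
        exact (hs' x hx).1
      · have h3 : cellCount (G (0 + 2)) (lam ^ b) (2 * lam ^ a) ≤
            cellCount (G 2) (lam ^ b) (8 * lam ^ a) :=
          cellCount_mono (h0 b) subset_rfl (by linarith [h0 a])
        have h4 := hG.cellCount_eight_mul_le (i := 2) (h0 b) (h0 a)
        have h3' : (cellCount (G (0 + 2)) (lam ^ b) (2 * lam ^ a) : ℝ) ≤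
            cellCount (G 2) (lam ^ b) (8 * lam ^ a) := by exact_mod_cast h3
        rw [hm]
        linarith
    · gcongr
      intro p hp
      obtain ⟨x, hx, rfl⟩ := Finset.mem_image.1 hp
      exact (Finset.mem_product.1 (Finset.mem_filter.1 hx).1).1
  have h2 := hG.cellCount_mul_le (a := a) (b := b - a) (by omega) (i := 4) (by norm_num)
  rw [Nat.add_sub_cancel' hab, ← hcard] at h2
  calc (closePairs P (lam ^ a) : ℝ) * cellCount (G 0) (lam ^ a) 1
      ≤ m * P.card * cellCount (G 0) (lam ^ a) 1 := by gcongr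
    _ = 153 * P.card * (cellCount (G 0) (lam ^ a) 1 *
        cellCount (G 4) (lam ^ b) (lam ^ a)) := by rw [hm]; ring
    _ ≤ 153 * P.card * (765 * lam⁻¹ * P.card) := by gcongr
    _ = 117045 * (lam⁻¹ * (P.card : ℝ) ^ 2) := by ring
    _ ≤ lam⁻¹ ^ 2 * (lam⁻¹ * (P.card : ℝ) ^ 2) := by
        have := hG.pos
        gcongr
        exact hG.const_le (by norm_num)
    _ = _ := by ring

/-- If `r₁ / r₂` is a quotient with denominator of size about `lam ^ a`, then the map
`(p, q) ↦ p + (r₁ / r₂) q` at scale `lam ^ b` takes no more values than there are cells of length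
`lam ^ (a + b)` in the part of the ring of size at most `lam ^ a`. -/
lemma card_image_mul_le (hG : IsStableRing G lam J c) (hab : a + b ≤ J) {P : Finset ℝ}
    (hP : ∀ p ∈ P, p ∈ G 0 ∧ |p| ≤ 1) {r₁ r₂ : ℝ} (hr₁ : r₁ ∈ G 5) (hr₂ : r₂ ∈ G 5)
    (hr₂l : lam ^ c * lam ^ a ≤ r₂) (hr₂u : r₂ ≤ 2 * lam ^ a) (hr : |r₁| ≤ 2 * r₂) :
    (((P ×ˢ P).image fun x ↦ ⌊(x.1 + r₁ / r₂ * x.2) / lam ^ b⌋).card : ℝ) *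
      cellCount (G 0) (lam ^ a) 1 ≤ lam⁻¹ ^ (c + 3) * cellCount (G 0) (lam ^ (a + b)) 1 := by
  classical
  have h0 : ∀ n : ℕ, 0 < lam ^ n := fun n ↦ pow_pos hG.pos n
  have hr0 : 0 < r₂ := (mul_pos (h0 _) (h0 _)).trans_le hr₂l
  have ha1 := hG.pow_le_one' a
  obtain ⟨s, hs, hsi, hsinj⟩ := Finset.exists_subset_injOn_image_eq_of_surjOn
    (f := fun x : ℝ × ℝ ↦ ⌊(x.1 + r₁ / r₂ * x.2) / lam ^ b⌋) ((P ×ˢ P : Finset (ℝ × ℝ)) : Set (ℝ × ℝ))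
    ((P ×ˢ P).image fun x ↦ ⌊(x.1 + r₁ / r₂ * x.2) / lam ^ b⌋)
    (by rw [Finset.coe_image]; exact Set.surjOn_image _ _)
  rw [← hsinj, Finset.card_image_of_injOn hsi]
  have h1 : (s.card : ℝ) ≤
      3 * lam⁻¹ ^ c * cellCount (G 7) (lam ^ (a + b)) (8 * lam ^ a) := by
    refine card_le_mul_cellCount s (fun x ↦ r₂ * x.1 + r₁ * x.2) (h0 _) (fun x hx ↦ ⟨?_, ?_⟩)
      fun k ↦ ?_
    · obtain ⟨hx1, hx2⟩ := Finset.mem_product.1 (hs hx)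
      refine hG.add_mem 6 _ (hG.mul_mem 5 _ hr₂ _ (hG.mono (Nat.zero_le 5) (hP _ hx1).1) ?_) _
        (hG.mul_mem 5 _ hr₁ _ (hG.mono (Nat.zero_le 5) (hP _ hx2).1) ?_)
      · rw [abs_of_pos hr0]; linarith
      · linarith
    · obtain ⟨hx1, hx2⟩ := Finset.mem_product.1 (hs hx)
      refine (abs_add_le _ _).trans ?_
      rw [abs_mul, abs_mul, abs_of_pos hr0]
      have h1 := mul_le_of_le_one_right hr0.le (hP _ hx1).2
      have h2 := mul_le_of_le_one_right (abs_nonneg r₁) (hP _ hx2).2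
      linarith [h0 a]
    · refine (card_le_of_injOn_floor _ (fun x ↦ x.1 + r₁ / r₂ * x.2) (r := lam ^ b)
        (x := k * lam ^ (a + b) / r₂)
        (ℓ := lam ^ (a + b) / r₂) (h0 b) (div_pos (h0 _) hr0).le
        (hsi.mono (Finset.coe_subset.2 (Finset.filter_subset _ _))) fun x hx ↦ ?_).trans ?_
      · obtain ⟨-, e⟩ := Finset.mem_filter.1 hx
        rw [floor_div_eq_iff (h0 _)] at e
        have e' : (x.1 + r₁ / r₂ * x.2) * r₂ = r₂ * x.1 + r₁ * x.2 := by field_simp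
        rw [← add_div, div_le_iff₀ hr0, le_div_iff₀ hr0, e']
        constructor <;> linarith
      · have h2 : lam ^ (a + b) / r₂ / lam ^ b ≤ lam⁻¹ ^ c := by
          rw [div_div, div_le_iff₀ (mul_pos hr0 (h0 b)), inv_pow, inv_mul_eq_div, le_div_iff₀ (h0 c),
            pow_add]
          calc lam ^ a * lam ^ b * lam ^ c = (lam ^ c * lam ^ a) * lam ^ b := by ring
            _ ≤ r₂ * lam ^ b := mul_le_mul_of_nonneg_right hr₂l (h0 b).le
        linarith [hG.one_le_inv_pow c]
  have h2 := hG.cellCount_eight_mul_le (i := 7) (h0 (a + b)) (h0 a)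
  have h3 := hG.cellCount_mul_le hab (i := 9) (by norm_num)
  have hc := hG.one_le_inv_pow c
  have hc1 := hG.one_le_inv_pow (c + 1)
  calc (s.card : ℝ) * cellCount (G 0) (lam ^ a) 1
      ≤ 3 * lam⁻¹ ^ c * (51 * cellCount (G 9) (lam ^ (a + b)) (lam ^ a)) *
        cellCount (G 0) (lam ^ a) 1 := by
        gcongr
        refine h1.trans ?_
        gcongr
    _ = 153 * lam⁻¹ ^ c * (cellCount (G 0) (lam ^ a) 1 *
        cellCount (G 9) (lam ^ (a + b)) (lam ^ a)) := by ring
    _ ≤ 153 * lam⁻¹ ^ c * (765 * lam⁻¹ * cellCount (G 0) (lam ^ (a + b)) 1) := by gcongr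
    _ = 117045 * (lam⁻¹ ^ (c + 1) * cellCount (G 0) (lam ^ (a + b)) 1) := by ring
    _ ≤ lam⁻¹ ^ 2 * (lam⁻¹ ^ (c + 1) * cellCount (G 0) (lam ^ (a + b)) 1) := by
        gcongr
        exact hG.const_le (by norm_num)
    _ = _ := by ring

end IsStableRing

namespace IsStableRing

variable {G : ℕ → Set ℝ} {lam : ℝ} {J c a b : ℕ}

/-- The quotients of ring elements with denominator between `lam ^ (a + c)` and `lam ^ a`. -/
def quotients (G : ℕ → Set ℝ) (lam : ℝ) (c a : ℕ) : Set ℝ :=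
  {z | ∃ r₁ ∈ G 4, ∃ r₂ ∈ G 4, lam ^ c * lam ^ a ≤ r₂ ∧ r₂ ≤ lam ^ a ∧ z = r₁ / r₂}

/-- A quotient of two differences with large denominator can be normalised by multiplying both
differences by a ring element of the right size. -/
lemma div_mem_quotients (hG : IsStableRing G lam J c) (ha : a + 1 ≤ J) {u v : ℝ}
    (hu : u ∈ G 2) (hv : v ∈ G 2) (hu1 : lam ^ a ≤ |u|) (hu2 : |u| ≤ 2) :
    v / u ∈ quotients G lam c a := by
  have hlam := hG.pos
  have h0 : ∀ n : ℕ, 0 < lam ^ n := fun n ↦ pow_pos hlam n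
  have hu0 : 0 < |u| := (h0 a).trans_le hu1
  obtain ⟨w, hw, hw1, hw2⟩ := hG.exists_mem (lam ^ a / |u|) (by
    rw [le_div_iff₀ hu0]
    calc lam ^ J * |u| ≤ lam ^ (a + 1) * 2 :=
          mul_le_mul (pow_le_pow_of_le_one hG.pos.le (by linarith [hG.le_small]) ha) hu2
            hu0.le (h0 _).le
      _ = lam ^ a * (lam * 2) := by ring
      _ ≤ lam ^ a * 1 := by gcongr; linarith [hG.le_small]
      _ = lam ^ a := mul_one _) ((div_le_one hu0).2 hu1)
  have hw0 : 0 < w := (mul_pos (h0 _) (div_pos (h0 _) hu0)).trans_le hw1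
  have hw4 : |w| ≤ 4 := by
    rw [abs_of_pos hw0]
    exact hw2.trans (((div_le_one hu0).2 hu1).trans (by norm_num))
  have hw3 : w ∈ G 3 := hG.mono (by norm_num) hw
  have h3 : lam ^ c * lam ^ a ≤ w * |u| := by
    rwa [← mul_div_assoc, div_le_iff₀ hu0] at hw1
  have h4 : w * |u| ≤ lam ^ a := by rwa [le_div_iff₀ hu0] at hw2
  rcases abs_cases u with ⟨hu', -⟩ | ⟨hu', -⟩
  · rw [hu'] at h3 h4 hu0
    exact ⟨w * v, hG.mul_mem 3 _ hw3 _ (hG.subset_succ 2 hv) hw4, w * u,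
      hG.mul_mem 3 _ hw3 _ (hG.subset_succ 2 hu) hw4, h3, h4, (mul_div_mul_left _ _ hw0.ne').symm⟩
  · rw [hu'] at h3 h4 hu0
    exact ⟨w * -v, hG.mul_mem 3 _ hw3 _ (hG.neg_mem 2 _ hv) hw4, w * -u,
      hG.mul_mem 3 _ hw3 _ (hG.neg_mem 2 _ hu) hw4, h3, h4,
      by rw [mul_div_mul_left _ _ hw0.ne', neg_div_neg_eq]⟩

/-- There is a quotient `r₁ / r₂` with denominator of size about `lam ^ a` for which
`(p, q) ↦ p + (r₁ / r₂) q` has few collisions. Either the set of quotients is not almost invariant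
under `z ↦ z / 2` and `z ↦ (z + 1) / 2`; then one of the images of a quotient is far from all
quotients of differences, and there are no far collisions. Or the set of quotients is dense in
`[0, 1]`; then the average number of far collisions is small. -/
lemma exists_farCollisions_le (hG : IsStableRing G lam J c) (hab : a < b) (hb : b ≤ J)
    {P : Finset ℝ} (hP : ∀ p ∈ P, p ∈ G 0 ∧ |p| ≤ 1) :
    ∃ r₁ ∈ G 5, ∃ r₂ ∈ G 5, lam ^ c * lam ^ a ≤ r₂ ∧ r₂ ≤ 2 * lam ^ a ∧ |r₁| ≤ 2 * r₂ ∧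
      (farCollisions P (lam ^ b) (lam ^ a) (r₁ / r₂) : ℝ) ≤
        8 * (lam ^ b / lam ^ a) * (P.card : ℝ) ^ 4 := by
  classical
  have hlam := hG.pos
  have h0 : ∀ n : ℕ, 0 < lam ^ n := fun n ↦ pow_pos hlam n
  set s := lam ^ b / lam ^ a with hs
  have hs0 : 0 < s := div_pos (h0 _) (h0 _)
  have hs4 : s ≤ 1 / 1000 := by
    rw [hs, div_le_iff₀ (h0 a)]
    calc lam ^ b ≤ lam ^ (a + 1) :=
          pow_le_pow_of_le_one hG.pos.le (by linarith [hG.le_small]) hab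
      _ = lam * lam ^ a := pow_succ' _ _
      _ ≤ 1 / 1000 * lam ^ a := by
          gcongr
          exact hG.le_small
  have hpos : ∀ r : ℝ, lam ^ c * lam ^ a ≤ r → 0 < r := fun r hr ↦
    (mul_pos (h0 _) (h0 _)).trans_le hr
  by_cases hcase : ∀ z ∈ quotients G lam c a, -1 ≤ z → z ≤ 2 →
      (∃ z' ∈ quotients G lam c a, |z' - z / 2| ≤ s) ∧
        ∃ z' ∈ quotients G lam c a, |z' - (z + 1) / 2| ≤ s
  · have hzero : (0 : ℝ) ∈ quotients G lam c a := by
      obtain ⟨w, hw, hw1, hw2⟩ := hG.exists_mem (lam ^ a)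
        (pow_le_pow_of_le_one hG.pos.le (by linarith [hG.le_small]) (by omega)) (hG.pow_le_one' a)
      refine ⟨0, ?_, w, hG.mono (by norm_num) hw, hw1, hw2, by simp⟩
      have := hG.sub_mem hG.one_mem hG.one_mem
      rw [sub_self] at this
      exact hG.mono (by norm_num) this
    have hdense : ∀ y ∈ Set.Icc (0 : ℝ) 1, ∃ z ∈ quotients G lam c a, |z - y| ≤ 3 * s :=
      fun y hy ↦ exists_near_of_halving hs0 (by linarith) hzero hcase hy
    set n : ℕ := ⌊1 / (8 * s)⌋₊ with hn
    have hns : (n : ℝ) * (8 * s) ≤ 1 := by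
      rw [← le_div_iff₀ (by positivity)]
      exact Nat.floor_le (by positivity)
    have hns' : 1 ≤ ((n : ℝ) + 1) * (8 * s) := by
      rw [← div_le_iff₀ (by positivity)]
      exact (Nat.lt_floor_add_one _).le
    have hchoose : ∀ k : ℕ, ∃ z, k ≤ n → z ∈ quotients G lam c a ∧ |z - k * (8 * s)| ≤ 3 * s := by
      intro k
      by_cases hk : k ≤ n
      · have hk' : (k : ℝ) ≤ n := by exact_mod_cast hk
        obtain ⟨z, hz, hz'⟩ := hdense (k * (8 * s)) ⟨by positivity, by nlinarith⟩
        exact ⟨z, fun _ ↦ ⟨hz, hz'⟩⟩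
      · exact ⟨0, fun h ↦ absurd h hk⟩
    choose z hz using hchoose
    have hsep : ∀ k ≤ n, ∀ l ≤ n, |z k - z l| < 2 * s → k = l := by
      intro k hk l hl h
      by_contra hne
      have h1 := abs_le.1 (hz k hk).2
      have h2 := abs_le.1 (hz l hl).2
      have h3 := abs_lt.1 h
      rcases lt_or_gt_of_ne hne with hlt | hlt
      · have h4 : (k : ℝ) + 1 ≤ l := by exact_mod_cast hlt
        nlinarith
      · have h4 : (l : ℝ) + 1 ≤ k := by exact_mod_cast hlt
        nlinarith
    have hinj : Set.InjOn z (Finset.range (n + 1) : Set ℕ) := by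
      intro k hk l hl e
      refine hsep k (by simpa [Nat.lt_succ_iff] using hk) l (by simpa [Nat.lt_succ_iff] using hl) ?_
      rw [e, sub_self, abs_zero]; positivity
    set Z := (Finset.range (n + 1)).image z with hZ
    have hZcard : (Z.card : ℝ) = n + 1 := by
      rw [hZ, Finset.card_image_of_injOn hinj]; simp
    have hsum : (∑ y ∈ Z, farCollisions P (lam ^ b) (lam ^ a) y : ℝ) ≤ 1 * (P.card : ℝ) ^ 4 := by
      refine sum_farCollisions_le P Z (h0 a) (h0 b) fun Z' hZ' x hx ↦ ?_
      norm_cast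
      rw [Finset.card_le_one]
      intro y hy y' hy'
      obtain ⟨k, hk, rfl⟩ := Finset.mem_image.1 (hZ' hy)
      obtain ⟨l, hl, rfl⟩ := Finset.mem_image.1 (hZ' hy')
      rw [Finset.mem_range, Nat.lt_succ_iff] at hk hl
      rw [hsep k hk l hl]
      have h1 := abs_lt.1 (hx _ hy)
      have h2 := abs_lt.1 (hx _ hy')
      rw [← hs] at h1 h2
      exact abs_lt.2 ⟨by linarith, by linarith⟩
    obtain ⟨y, hy, hfar⟩ : ∃ y ∈ Z, (farCollisions P (lam ^ b) (lam ^ a) y : ℝ) ≤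
        8 * s * (P.card : ℝ) ^ 4 := by
      by_contra! hcon
      have hne : Z.Nonempty := by
        rw [← Finset.card_pos, ← Nat.cast_pos (α := ℝ), hZcard]; positivity
      have := Finset.sum_lt_sum_of_nonempty hne hcon
      rw [Finset.sum_const, nsmul_eq_mul, hZcard] at this
      have h1 : 1 * (P.card : ℝ) ^ 4 ≤ ((n : ℝ) + 1) * (8 * s) * (P.card : ℝ) ^ 4 := by gcongr
      linarith
    obtain ⟨k, hk, rfl⟩ := Finset.mem_image.1 hy
    rw [Finset.mem_range, Nat.lt_succ_iff] at hk
    obtain ⟨⟨r₁, hr₁, r₂, hr₂, hl, hu, e⟩, hzk⟩ := hz k hk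
    rw [e] at hfar hzk
    have hr0 := hpos _ hl
    refine ⟨r₁, hG.subset_succ 4 hr₁, r₂, hG.subset_succ 4 hr₂, hl, by linarith [h0 a], ?_, hfar⟩
    have h1 : |r₁ / r₂| ≤ 2 := by
      have h2 := abs_le.1 hzk
      have h3 : (k : ℝ) ≤ n := by exact_mod_cast hk
      have h4 : 0 ≤ (k : ℝ) * (8 * s) := by positivity
      exact abs_le.2 ⟨by linarith, by nlinarith⟩
    rwa [abs_div, abs_of_pos hr0, div_le_iff₀ hr0] at h1
  · have hfar : ∀ z : ℝ, (∀ z' ∈ quotients G lam c a, ¬ |z' - z| ≤ s) →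
        (farCollisions P (lam ^ b) (lam ^ a) z : ℝ) ≤ 8 * s * (P.card : ℝ) ^ 4 := by
      intro z hz
      have : farCollisions P (lam ^ b) (lam ^ a) z = 0 := by
        rw [farCollisions, Finset.card_eq_zero, Finset.filter_eq_empty_iff]
        rintro ⟨⟨p, q⟩, p', q'⟩ hx ⟨h1, h2⟩
        simp only [Finset.mem_product] at hx
        obtain ⟨⟨hp, hq⟩, hp', hq'⟩ := hx
        dsimp only at h1 h2
        have hu0 : 0 < |q - q'| := (h0 a).trans_le h1
        have hu : q - q' ≠ 0 := abs_pos.1 hu0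
        refine hz ((p' - p) / (q - q')) (hG.div_mem_quotients (by omega)
          (hG.sub_mem (hP q hq).1 (hP q' hq').1) (hG.sub_mem (hP p' hp').1 (hP p hp).1) h1 ?_) ?_
        · have h3 := abs_le.1 (hP q hq).2
          have h4 := abs_le.1 (hP q' hq').2
          exact abs_le.2 ⟨by linarith, by linarith⟩
        · have h3 : (p' - p) / (q - q') - z = -(p - p' + z * (q - q')) / (q - q') := by
            field_simp; ring
          rw [h3, abs_div, abs_neg, hs]
          exact div_le_div₀ (h0 b).le h2.le (h0 a) h1
      rw [this]
      push_cast
      positivity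
    have hlarge : ∀ r₁ r₂ : ℝ, lam ^ c * lam ^ a ≤ r₂ → -1 ≤ r₁ / r₂ → r₁ / r₂ ≤ 2 →
        |r₁| ≤ 2 * r₂ ∧ -r₂ ≤ r₁ ∧ r₁ ≤ 2 * r₂ := by
      intro r₁ r₂ hl h1 h2
      have hr0 := hpos _ hl
      rw [le_div_iff₀ hr0] at h1
      rw [div_le_iff₀ hr0] at h2
      exact ⟨abs_le.2 ⟨by linarith, h2⟩, by linarith, h2⟩
    push Not at hcase
    obtain ⟨z, ⟨r₁, hr₁, r₂, hr₂, hl, hu, rfl⟩, hz1, hz2, hz⟩ := hcase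
    have hr0 := hpos _ hl
    obtain ⟨h1, h2, h3⟩ := hlarge r₁ r₂ hl hz1 hz2
    have htwo : 2 * r₂ ∈ G 5 := by rw [two_mul]; exact hG.add_mem 4 _ hr₂ _ hr₂
    by_cases hz' : ∃ z' ∈ quotients G lam c a, |z' - r₁ / r₂ / 2| ≤ s
    · refine ⟨r₁ + r₂, hG.add_mem 4 _ hr₁ _ hr₂, 2 * r₂, htwo, by linarith, by linarith,
        abs_le.2 ⟨by linarith, by linarith⟩, ?_⟩
      have e : (r₁ + r₂) / (2 * r₂) = (r₁ / r₂ + 1) / 2 := by field_simp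
      rw [e]
      exact hfar _ fun z' hz'' ↦ not_le.2 (hz hz' z' hz'')
    · refine ⟨r₁, hG.subset_succ 4 hr₁, 2 * r₂, htwo, by linarith, by linarith, by linarith, ?_⟩
      have e : r₁ / (2 * r₂) = r₁ / r₂ / 2 := by field_simp
      rw [e]
      push Not at hz'
      exact hfar _ fun z' hz'' ↦ not_le.2 (hz' z' hz'')

/-- The expansion of a stable filtered ring: if the ring does not fill the scale `lam ^ b`, then
covering numbers at scale `lam ^ (a + b)` are larger than superadditivity predicts. -/
lemma mul_sq_le_cellCount_add (hG : IsStableRing G lam J c) (hab : a < b) (hJ : a + b ≤ J)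
    (hfull : (cellCount (G 0) (lam ^ b) 1 : ℝ) * lam ^ b ≤ lam ^ (2 * a)) :
    (cellCount (G 0) (lam ^ b) 1 : ℝ) * (cellCount (G 0) (lam ^ a) 1 : ℝ) ^ 2 ≤
      lam⁻¹ ^ (c + 7) * cellCount (G 0) (lam ^ (a + b)) 1 := by
  classical
  have hlam := hG.pos
  have h0 : ∀ n : ℕ, 0 < lam ^ n := fun n ↦ pow_pos hlam n
  obtain ⟨P, hP, hinj, hcard⟩ := exists_cell_representatives (G 0) (h0 b) 1
  obtain ⟨r₁, hr₁, r₂, hr₂, hl, hu, hr, hfar⟩ := hG.exists_farCollisions_le hab (by omega) hP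
  have hclose := hG.closePairs_mul_le hab.le (by omega) hP hinj hcard
  have himage := hG.card_image_mul_le hJ hP hr₁ hr₂ hl hu hr
  have hcoll := collisions_le (h0 b) hinj (lam ^ a) (r₁ / r₂)
  have hCS := card_pow_four_le P (lam ^ b) (r₁ / r₂)
  have hMa := cellCount_le (G := G 0) (h0 a) (zero_le_one' ℝ)
  rw [← hcard] at hfull ⊢
  set I : ℝ := (((P ×ˢ P).image fun x ↦ ⌊(x.1 + r₁ / r₂ * x.2) / lam ^ b⌋).card : ℝ) with hI
  have hI0 : 0 ≤ I := Nat.cast_nonneg _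
  set M : ℝ := (cellCount (G 0) (lam ^ a) 1 : ℝ) with hM
  have hM0 : 0 ≤ M := Nat.cast_nonneg _
  set N : ℝ := (P.card : ℝ) with hN
  have hN0 : 0 ≤ N := Nat.cast_nonneg _
  rcases hN0.eq_or_lt with hN0' | hN0'
  · rw [← hN0', zero_mul]
    have := hG.one_le_inv_pow (c + 7)
    positivity
  have hMa' : M * lam ^ a ≤ 4 := by
    have h1 := hG.pow_le_one' a
    rw [mul_one] at hMa
    calc M * lam ^ a ≤ (2 / lam ^ a + 2) * lam ^ a := by have := h0 a; gcongr
      _ = 2 + 2 * lam ^ a := by rw [add_mul, div_mul_cancel₀ _ (h0 a).ne']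
      _ ≤ 4 := by linarith
  have hfarM : 8 * (lam ^ b / lam ^ a) * N ^ 4 * M ≤ 32 * N ^ 3 := by
    calc 8 * (lam ^ b / lam ^ a) * N ^ 4 * M = 8 * N ^ 3 * (N * lam ^ b) * M / lam ^ a := by ring
      _ ≤ 8 * N ^ 3 * lam ^ (2 * a) * M / lam ^ a := by have := h0 a; gcongr
      _ = 8 * N ^ 3 * (M * lam ^ a) := by
          rw [two_mul, pow_add]; field_simp
      _ ≤ 8 * N ^ 3 * 4 := by gcongr
      _ = 32 * N ^ 3 := by ring
  have hcollM : collisions P (lam ^ b) (r₁ / r₂) * M ≤ lam⁻¹ ^ 4 * N ^ 3 := by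
    calc collisions P (lam ^ b) (r₁ / r₂) * M
        ≤ (4 * (N * closePairs P (lam ^ a)) + 8 * (lam ^ b / lam ^ a) * N ^ 4) * M := by
          gcongr
          exact hcoll.trans (by gcongr)
      _ = 4 * N * (closePairs P (lam ^ a) * M) + 8 * (lam ^ b / lam ^ a) * N ^ 4 * M := by ring
      _ ≤ 4 * N * (lam⁻¹ ^ 3 * N ^ 2) + 32 * N ^ 3 := by gcongr
      _ = (4 * lam⁻¹ ^ 3 + 32) * N ^ 3 := by ring
      _ ≤ lam⁻¹ ^ 4 * N ^ 3 := by
          gcongr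
          have h1 := hG.le_inv
          have h2 := hG.one_le_inv_pow 3
          nlinarith
  have hNM : N * M ≤ lam⁻¹ ^ 4 * I := by
    have h1 : N ^ 3 * (N * M) ≤ N ^ 3 * (lam⁻¹ ^ 4 * I) := by
      calc N ^ 3 * (N * M) = N ^ 4 * M := by ring
        _ ≤ I * collisions P (lam ^ b) (r₁ / r₂) * M := by gcongr
        _ = I * (collisions P (lam ^ b) (r₁ / r₂) * M) := by ring
        _ ≤ I * (lam⁻¹ ^ 4 * N ^ 3) := by gcongr
        _ = _ := by ring
    exact le_of_mul_le_mul_left h1 (by positivity)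
  have h4 := hG.one_le_inv_pow 4
  calc N * M ^ 2 = N * M * M := by ring
    _ ≤ lam⁻¹ ^ 4 * I * M := by gcongr
    _ = lam⁻¹ ^ 4 * (I * M) := by ring
    _ ≤ lam⁻¹ ^ 4 * (lam⁻¹ ^ (c + 3) * cellCount (G 0) (lam ^ (a + b)) 1) := by gcongr
    _ = _ := by ring

end IsStableRing

/-! ### From expansion to full covering numbers -/

/-- A function `φ` that is superadditive and expanding up to a constant `C` has almost full growth
`φ J ≥ (1 - η) J`. Otherwise superadditivity gives `φ b ≤ (1 - η / 2) b` for all `b` much smaller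
than `J`, so that the expansion hypothesis applies to `b = j a` for `j` large; it increases the
ratio `φ a / a` by the factor `5 / 4` when `a` is replaced by `n a`, and after boundedly many steps
the ratio exceeds its trivial upper bound. -/
lemma exists_almost_full {η κ C : ℝ} (hη : 0 < η) (hη1 : η ≤ 1) (hκ : 0 < κ) (hC : 0 ≤ C) :
    ∃ J : ℕ, 1 ≤ J ∧ ∀ φ : ℕ → ℝ,
      (∀ a b, a + b ≤ J → φ a + φ b - C ≤ φ (a + b)) →
      (∀ j ≤ J, κ * j - C ≤ φ j) → (∀ j ≤ J, φ j ≤ j + C) →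
      (∀ a b, a < b → a + b ≤ J → φ b + 2 * a ≤ b → φ b + 2 * φ a - C ≤ φ (a + b)) →
      (1 - η) * J ≤ φ J := by
  obtain ⟨j₀, hj₀⟩ := exists_nat_ge (4 / η + 2)
  obtain ⟨a₀, ha₀⟩ := exists_nat_ge (8 * C / κ + 16 * C / η + 1)
  obtain ⟨K, hK⟩ := pow_unbounded_of_one_lt (2 * (1 + C) / κ) (by norm_num : (1 : ℝ) < 5 / 4)
  have hj₀' : 4 ≤ η * j₀ := by
    have h1 : 4 / η ≤ j₀ := by linarith
    rw [div_le_iff₀ hη] at h1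
    linarith
  have hj₀2 : 2 ≤ j₀ := by
    have : (2 : ℝ) ≤ j₀ := by have : 0 < 4 / η := by positivity
                              linarith
    exact_mod_cast this
  have ha₀κ : 8 * C ≤ κ * a₀ := by
    have : 8 * C / κ ≤ a₀ := by have : 0 ≤ 16 * C / η := by positivity
                                linarith
    rw [div_le_iff₀ hκ] at this
    linarith
  have ha₀η : 16 * C ≤ η * a₀ := by
    have : 16 * C / η ≤ a₀ := by have : 0 ≤ 8 * C / κ := by positivity
                                 linarith
    rw [div_le_iff₀ hη] at this
    linarith
  have ha₀1 : 1 ≤ a₀ := by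
    have : (1 : ℝ) ≤ a₀ := by
      have h1 : 0 ≤ 8 * C / κ := by positivity
      have h2 : 0 ≤ 16 * C / η := by positivity
      linarith
    exact_mod_cast this
  set n := 4 * j₀ with hn
  have hn1 : 1 ≤ n := by omega
  set A := a₀ * n ^ K with hA
  have hA1 : 1 ≤ A := Nat.mul_pos ha₀1 (Nat.pow_pos hn1)
  obtain ⟨J, hJ⟩ := exists_nat_ge (4 * A / η)
  have hJ' : 4 * (A : ℝ) ≤ η * J := by
    rw [div_le_iff₀ hη] at hJ
    linarith
  have hA1' : (1 : ℝ) ≤ A := by exact_mod_cast hA1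
  have hAJ' : 4 * (A : ℝ) ≤ J := by
    have : η * J ≤ 1 * J := by gcongr
    linarith
  have hAJ : 4 * A ≤ J := by exact_mod_cast hAJ'
  refine ⟨J, by omega, fun φ hsup hlow hup hexp ↦ ?_⟩
  by_contra! hcon
  -- superadditivity bounds `φ b` by its average up to `J`
  have hb : ∀ b, a₀ ≤ b → b ≤ A → φ b ≤ (1 - η / 2) * b := by
    intro b hb1 hb2
    have hmul : ∀ m : ℕ, m * b ≤ J → m * φ b - (m + 1) * C ≤ φ (m * b) := by
      intro m
      induction m with
      | zero =>
        intro _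
        have := hlow 0 (Nat.zero_le _)
        simp only [Nat.cast_zero, zero_mul, mul_zero] at this ⊢
        linarith
      | succ m ih =>
        intro hm
        have h1 := hsup (m * b) b (by linarith)
        have h2 := ih (by linarith)
        rw [Nat.succ_mul]
        push_cast
        linarith
    have hb0 : 0 < b := by omega
    have hdiv := Nat.div_add_mod' J b
    have hmod := Nat.mod_lt J hb0
    set m := J / b with hm
    have h1 := hmul m (by omega)
    have h2 := hsup (m * b) (J % b) (by omega)
    rw [hdiv] at h2
    have h3 := hlow (J % b) (by omega)
    have h4 : 0 ≤ κ * ((J % b : ℕ) : ℝ) := by positivity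
    have hm1 : 1 ≤ m := (Nat.one_le_div_iff hb0).2 (by omega)
    have hm1' : (1 : ℝ) ≤ m := by exact_mod_cast hm1
    have hb2' : (b : ℝ) ≤ A := by exact_mod_cast hb2
    have hb1' : (a₀ : ℝ) ≤ b := by exact_mod_cast hb1
    have h5 : (J : ℝ) ≤ m * b + b := by
      have : J ≤ m * b + b := by omega
      exact_mod_cast this
    have h6 : (1 - η / 4) * J ≤ m * b := by linarith
    have h7 : (1 - η) * J ≤ (1 - 3 * η / 4) * (m * b) := by
      have h8 : (1 - 3 * η / 4) * ((1 - η / 4) * J) ≤ (1 - 3 * η / 4) * (m * b) :=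
        mul_le_mul_of_nonneg_left h6 (by linarith)
      have h9 : (0 : ℝ) ≤ η ^ 2 * J := by positivity
      nlinarith
    have h8 : m * φ b ≤ m * ((1 - 3 * η / 4) * b + 4 * C) := by
      have : C ≤ m * C := le_mul_of_one_le_left hC hm1'
      linarith
    have h9 := le_of_mul_le_mul_left h8 (by linarith)
    have h10 : 16 * C ≤ η * b := ha₀η.trans (by gcongr)
    linarith
  have hgrow : ∀ k ≤ K, κ / 2 * (5 / 4) ^ k * (a₀ * n ^ k : ℕ) ≤ φ (a₀ * n ^ k) := by
    intro k
    induction k with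
    | zero =>
      intro _
      have h1 := hlow a₀ (by
        have : a₀ * 1 ≤ A := Nat.mul_le_mul_left _ (Nat.pow_pos hn1)
        omega)
      simp only [pow_zero, mul_one]
      linarith
    | succ k ih =>
      intro hk
      set a := a₀ * n ^ k with ha
      have hna : a₀ * n ^ (k + 1) = n * a := by rw [ha, pow_succ]; ring
      have hnaA : n * a ≤ A := by
        rw [← hna]
        exact Nat.mul_le_mul_left _ (Nat.pow_le_pow_right hn1 hk)
      have haa₀ : a₀ ≤ a := Nat.le_mul_of_pos_right _ (Nat.pow_pos hn1)
      have ha1 : 1 ≤ a := by omega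
      have ih' := ih (by omega)
      have hstep : ∀ i : ℕ, j₀ + i ≤ n → i * (2 * φ a - C) - C ≤ φ ((j₀ + i) * a) := by
        intro i
        induction i with
        | zero =>
          intro _
          have h1 : j₀ * a ≤ n * a := Nat.mul_le_mul_right _ (by omega)
          have h2 := hlow (j₀ * a) (by omega)
          have h3 : (0 : ℝ) ≤ κ * (j₀ * a : ℕ) := by positivity
          simp only [Nat.cast_zero, zero_mul, add_zero]
          linarith
        | succ i ih2 =>
          intro hi
          have h0 := ih2 (by omega)
          have h1 : (j₀ + (i + 1)) * a ≤ n * a := Nat.mul_le_mul_right _ hi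
          have h2 : a + (j₀ + i) * a = (j₀ + (i + 1)) * a := by ring
          have h3 : 2 * a ≤ (j₀ + i) * a := Nat.mul_le_mul_right _ (by omega)
          have h4 := hb ((j₀ + i) * a) (by omega) (by omega)
          have h5 : 4 * (a : ℝ) ≤ η * ((j₀ + i) * a : ℕ) := by
            push_cast
            have h6 : (0 : ℝ) ≤ η * i * a := by positivity
            have h7 : 4 * (a : ℝ) ≤ η * j₀ * a := by gcongr
            linarith
          have h6 := hexp a ((j₀ + i) * a) (by omega) (by omega) (by linarith)
          rw [h2] at h6
          push_cast
          linarith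
      have h1 := hstep (3 * j₀) (by omega)
      rw [show j₀ + 3 * j₀ = n by omega] at h1
      rw [hna]
      set x : ℝ := κ / 2 * (5 / 4) ^ k with hx
      have hx1 : κ / 2 ≤ x :=
        le_mul_of_one_le_right (by positivity) (one_le_pow₀ (by norm_num))
      have hCx : 4 * C ≤ x * a := by
        have h2 : (a₀ : ℝ) ≤ a := by exact_mod_cast haa₀
        have h3 : κ / 2 * a₀ ≤ x * a := by gcongr
        linarith
      have hj1 : (1 : ℝ) ≤ j₀ := by exact_mod_cast (by omega : 1 ≤ j₀)
      have h2 : (j₀ : ℝ) * (x * a) ≤ j₀ * φ a := by gcongr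
      have h3 : (j₀ : ℝ) * (4 * C) ≤ j₀ * (x * a) := by gcongr
      have h4 : C ≤ j₀ * C := le_mul_of_one_le_left hC hj1
      have h5 : κ / 2 * (5 / 4) ^ (k + 1) = 5 / 4 * x := by rw [hx, pow_succ]; ring
      rw [h5, hn]
      push_cast at h1 ⊢
      linarith
  have h1 := hgrow K le_rfl
  have h2 := hup A (by omega)
  rw [← hA] at h1
  have h3 : 1 + C < κ / 2 * (5 / 4) ^ K := by
    rw [div_lt_iff₀ hκ] at hK
    linarith
  have h4 : (1 + C) * A < κ / 2 * (5 / 4) ^ K * A := by gcongr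
  have h5 : C ≤ C * A := le_mul_of_one_le_right hC hA1'
  linarith

/-- A stable filtered ring of positive dimension has almost full covering numbers at its smallest
scale. -/
lemma exists_cellCount_ge {η κ : ℝ} (hη : 0 < η) (hη1 : η ≤ 1) (hκ : 0 < κ) (c : ℕ) :
    ∃ J : ℕ, 1 ≤ J ∧ ∀ (G : ℕ → Set ℝ) (lam : ℝ), IsStableRing G lam J c →
      (∀ j ≤ J, lam⁻¹ ^ (κ * j - 1) ≤ (cellCount (G 0) (lam ^ j) 1 : ℝ)) →
      lam⁻¹ ^ ((1 - η) * J) ≤ (cellCount (G 0) (lam ^ J) 1 : ℝ) := by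
  obtain ⟨J, hJ1, hJ⟩ := exists_almost_full hη hη1 hκ (by positivity : (0 : ℝ) ≤ (c + 7 : ℕ))
  refine ⟨J, hJ1, fun G lam hG hlow ↦ ?_⟩
  have hlam := hG.pos
  have hb : 1 < lam⁻¹ := by linarith [hG.le_inv]
  have hb0 : 0 < lam⁻¹ := by linarith
  have hM : ∀ j : ℕ, (1 : ℝ) ≤ cellCount (G 0) (lam ^ j) 1 := by
    intro j
    have h : 0 < cellCount (G 0) (lam ^ j) 1 :=
      (Set.ncard_pos (finite_cells (pow_pos hlam j))).2
        ⟨_, Set.mem_image_of_mem _ ⟨hG.one_mem, by norm_num⟩⟩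
    exact_mod_cast h
  have hM0 : ∀ j : ℕ, (0 : ℝ) < cellCount (G 0) (lam ^ j) 1 := fun j ↦ by linarith [hM j]
  have hpow : ∀ k : ℕ, Real.logb lam⁻¹ (lam⁻¹ ^ k) = k := fun k ↦ by
    rw [Real.logb_pow, Real.logb_self_eq_one hb, mul_one]
  have key := hJ (fun j ↦ Real.logb lam⁻¹ (cellCount (G 0) (lam ^ j) 1)) ?_ ?_ ?_ ?_
  · rwa [Real.le_logb_iff_rpow_le hb (hM0 J)] at key
  · intro a b hab
    have h := Real.logb_le_logb_of_le hb (mul_pos (hM0 a) (hM0 b)) (hG.mul_le_cellCount_add hab)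
    rw [Real.logb_mul (hM0 a).ne' (hM0 b).ne', Real.logb_mul (by positivity) (hM0 _).ne',
      hpow] at h
    linarith
  · intro j hj
    have h := (Real.le_logb_iff_rpow_le hb (hM0 j)).2 (hlow j hj)
    have : (1 : ℝ) ≤ (c + 7 : ℕ) := by push_cast; linarith [(Nat.cast_nonneg c : (0 : ℝ) ≤ c)]
    linarith
  · intro j hj
    have h1 := cellCount_le (G := G 0) (pow_pos hlam j) (zero_le_one' ℝ)
    have h2 : (cellCount (G 0) (lam ^ j) 1 : ℝ) ≤ lam⁻¹ ^ (j + 1) := by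
      refine h1.trans ?_
      have h3 := hG.one_le_inv_pow j
      have h4 := hG.le_inv
      rw [mul_one, div_eq_mul_inv, ← inv_pow, pow_succ]
      nlinarith
    have h := Real.logb_le_logb_of_le hb (hM0 j) h2
    rw [hpow] at h
    push_cast at h ⊢
    linarith [(Nat.cast_nonneg c : (0 : ℝ) ≤ c)]
  · intro a b hab haJ hfull
    have hfull' : (cellCount (G 0) (lam ^ b) 1 : ℝ) * lam ^ b ≤ lam ^ (2 * a) := by
      have h1 : Real.logb lam⁻¹ (cellCount (G 0) (lam ^ b) 1 * lam⁻¹ ^ (2 * a)) ≤ b := by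
        rw [Real.logb_mul (hM0 b).ne' (by positivity), hpow]
        push_cast
        exact hfull
      rw [Real.logb_le_iff_le_rpow hb (by have := hM0 b; positivity), Real.rpow_natCast] at h1
      rw [inv_pow, inv_pow, ← div_eq_mul_inv, div_le_iff₀ (by positivity), inv_mul_eq_div,
        le_div_iff₀ (by positivity)] at h1
      exact h1
    have h := Real.logb_le_logb_of_le hb
      (mul_pos (hM0 b) (pow_pos (hM0 a) 2)) (hG.mul_sq_le_cellCount_add hab haJ hfull')
    rw [Real.logb_mul (hM0 b).ne' (pow_pos (hM0 a) 2).ne', Real.logb_pow,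
      Real.logb_mul (by positivity) (hM0 _).ne', hpow] at h
    push_cast at h ⊢
    linarith

/-- Since covering numbers are bounded, they must be stable along some stretch of twenty steps of a
filtration, simultaneously at all scales `lam ^ j`. -/
lemma IsFilteredRing.exists_stable_level {G : ℕ → Set ℝ} (hG : IsFilteredRing G) {lam : ℝ}
    (hlam : 0 < lam) (hlam1 : lam ≤ 1 / 1000) (i₀ J : ℕ) :
    ∃ i ≤ (J + 1) ^ 2, ∀ j ≤ J, (cellCount (G (i₀ + 20 * (i + 1))) (lam ^ j) 1 : ℝ) ≤
      lam⁻¹ * cellCount (G (i₀ + 20 * i)) (lam ^ j) 1 := by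
  by_contra! hcon
  have hinv : 1000 ≤ lam⁻¹ := by
    rw [le_inv_comm₀ (by norm_num) hlam]; linarith
  set F : ℕ → ℕ → ℝ := fun i j ↦ (cellCount (G (i₀ + 20 * i)) (lam ^ j) 1 : ℝ) with hF
  have hF1 : ∀ i j, 1 ≤ F i j := by
    intro i j
    have h : 0 < cellCount (G (i₀ + 20 * i)) (lam ^ j) 1 :=
      (Set.ncard_pos (finite_cells (pow_pos hlam j))).2
        ⟨_, Set.mem_image_of_mem _ ⟨hG.mono (Nat.zero_le _) hG.one_mem, by norm_num⟩⟩
    simp only [hF]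
    exact_mod_cast h
  have hFmono : ∀ i j, F i j ≤ F (i + 1) j := by
    intro i j
    have := cellCount_mono (R := 1) (pow_pos hlam j)
      (hG.mono (show i₀ + 20 * i ≤ i₀ + 20 * (i + 1) by omega)) le_rfl
    simp only [hF]
    exact_mod_cast this
  have hFup : ∀ i, ∀ j ∈ Finset.range (J + 1), F i j ≤ lam⁻¹ ^ (J + 1) := by
    intro i j hj
    rw [Finset.mem_range] at hj
    refine (cellCount_le (pow_pos hlam j) (zero_le_one' ℝ)).trans ?_
    have h1 : 1 ≤ lam⁻¹ ^ j := one_le_pow₀ (by linarith)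
    calc 2 * 1 / lam ^ j + 2 = 2 * lam⁻¹ ^ j + 2 := by rw [inv_pow]; ring
      _ ≤ lam⁻¹ ^ j * lam⁻¹ := by nlinarith
      _ = lam⁻¹ ^ (j + 1) := (pow_succ _ _).symm
      _ ≤ lam⁻¹ ^ (J + 1) := pow_le_pow_right₀ (by linarith) (by omega)
  have hgrow : ∀ i ≤ (J + 1) ^ 2 + 1, lam⁻¹ ^ i ≤ ∏ j ∈ Finset.range (J + 1), F i j := by
    intro i
    induction i with
    | zero =>
      intro _
      rw [pow_zero]
      calc (1 : ℝ) = ∏ j ∈ Finset.range (J + 1), 1 := Finset.prod_const_one.symm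
        _ ≤ _ := Finset.prod_le_prod (fun _ _ ↦ zero_le_one) fun j _ ↦ hF1 0 j
    | succ i ih =>
      intro hi
      obtain ⟨j, hj, hlt⟩ := hcon i (by omega)
      have hjm : j ∈ Finset.range (J + 1) := Finset.mem_range.2 (by omega)
      rw [pow_succ', ← Finset.mul_prod_erase _ _ hjm]
      have h1 := ih (by omega)
      rw [← Finset.mul_prod_erase _ _ hjm] at h1
      calc lam⁻¹ * lam⁻¹ ^ i ≤ lam⁻¹ * (F i j * ∏ k ∈ (Finset.range (J + 1)).erase j, F i k) := by
            gcongr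
        _ = lam⁻¹ * F i j * ∏ k ∈ (Finset.range (J + 1)).erase j, F i k := by ring
        _ ≤ F (i + 1) j * ∏ k ∈ (Finset.range (J + 1)).erase j, F (i + 1) k := by
            refine mul_le_mul hlt.le ?_ ?_ (by linarith [hF1 (i + 1) j])
            · exact Finset.prod_le_prod (fun k _ ↦ by linarith [hF1 i k]) fun k _ ↦ hFmono i k
            · exact Finset.prod_nonneg fun k _ ↦ by linarith [hF1 i k]
  have h1 := hgrow _ le_rfl
  have h2 : ∏ j ∈ Finset.range (J + 1), F ((J + 1) ^ 2 + 1) j ≤ lam⁻¹ ^ ((J + 1) ^ 2) := by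
    calc _ ≤ ∏ j ∈ Finset.range (J + 1), lam⁻¹ ^ (J + 1) :=
          Finset.prod_le_prod (fun k _ ↦ by linarith [hF1 ((J + 1) ^ 2 + 1) k])
            (hFup ((J + 1) ^ 2 + 1))
      _ = lam⁻¹ ^ ((J + 1) ^ 2) := by
          rw [Finset.prod_const, Finset.card_range, ← pow_mul, pow_two]
  have h3 : lam⁻¹ ^ ((J + 1) ^ 2) < lam⁻¹ ^ ((J + 1) ^ 2 + 1) :=
    pow_lt_pow_right₀ (by linarith) (Nat.lt_succ_self _)
  linarith

/-! ### Expansion of a set of integers by many dilations -/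

/-- If `S + ⌊z S⌋` is not much larger than `S` for every `z` in a set `Z` of points in different
cells of length `δ`, then `Z` cannot be large. -/
lemma card_le_of_card_add_le (S : Finset ℤ) (hS : S.Nonempty) (Z : Finset ℝ) {δ D Q τ : ℝ}
    (hδ : 0 < δ) (hD : 0 < D) (hQ : 0 ≤ Q)
    (hZinj : Set.InjOn (fun z : ℝ ↦ ⌊z / δ⌋) (Z : Set ℝ))
    (hZ : ∀ z ∈ Z, ((S + S.image (fun a : ℤ ↦ ⌊z * a⌋)).card : ℝ) ≤ Q * S.card)
    (hτ : ∀ n ∈ S, ((S.filter fun m : ℤ ↦ |(n : ℝ) - m| < D).card : ℝ) ≤ τ * S.card) :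
    (Z.card : ℝ) ≤ Q * (4 * τ * Z.card + (2 / (δ * D) + 2) * S.card) := by
  classical
  set P : Finset ℝ := S.map ⟨fun n : ℤ ↦ (n : ℝ), Int.cast_injective⟩ with hP
  have hPcard : P.card = S.card := Finset.card_map _
  have hN0 : (0 : ℝ) < S.card := by exact_mod_cast hS.card_pos
  have hPinj : Set.InjOn (fun g : ℝ ↦ ⌊g / 1⌋) (P : Set ℝ) := by
    intro x hx y hy e
    obtain ⟨n, -, rfl⟩ := Finset.mem_map.1 (Finset.mem_coe.1 hx)
    obtain ⟨m, -, rfl⟩ := Finset.mem_map.1 (Finset.mem_coe.1 hy)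
    simpa using e
  have hclose : (closePairs P D : ℝ) ≤ τ * (S.card : ℝ) ^ 2 := by
    refine (card_le_mul_card_image_real _ (fun x : ℝ × ℝ ↦ x.1) (τ * S.card) fun p hp ↦ ?_).trans ?_
    · obtain ⟨x, hx, rfl⟩ := Finset.mem_image.1 hp
      obtain ⟨n, hn, hnx⟩ :=
        Finset.mem_map.1 (Finset.mem_product.1 (Finset.mem_filter.1 hx).1).1
      refine le_trans ?_ (hτ n hn)
      rw [← Finset.card_map ⟨fun n : ℤ ↦ (n : ℝ), Int.cast_injective⟩]
      refine Nat.cast_le.2 (Finset.card_le_card_of_injOn Prod.snd (fun y hy ↦ ?_) fun y hy y' hy' e ↦ ?_)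
      · obtain ⟨hy, hy1⟩ := Finset.mem_filter.1 (Finset.mem_coe.1 hy)
        obtain ⟨hy, hy2⟩ := Finset.mem_filter.1 hy
        obtain ⟨m, hm, hmy⟩ := Finset.mem_map.1 (Finset.mem_product.1 hy).2
        refine Finset.mem_coe.2 (Finset.mem_map.2 ⟨m, Finset.mem_filter.2 ⟨hm, ?_⟩, hmy⟩)
        rw [hy1, ← hnx, ← hmy] at hy2
        exact hy2
      · have h1 := (Finset.mem_filter.1 (Finset.mem_coe.1 hy)).2
        have h2 := (Finset.mem_filter.1 (Finset.mem_coe.1 hy')).2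
        exact Prod.ext (h1.trans h2.symm) e
    · have hτ0 : 0 ≤ τ * S.card := by
        obtain ⟨n, hn⟩ := hS
        exact (Nat.cast_nonneg _).trans (hτ n hn)
      rw [pow_two, ← mul_assoc]
      gcongr
      rw [← hPcard]
      gcongr
      intro p hp
      obtain ⟨x, hx, rfl⟩ := Finset.mem_image.1 hp
      exact (Finset.mem_product.1 (Finset.mem_filter.1 hx).1).1
  have hfar := sum_farCollisions_le P Z hD one_pos (m := 2 / (δ * D) + 2) fun Z' hZ' x hx ↦ by
    refine (card_le_of_injOn_floor Z' id (x := x - 1 / D) (ℓ := 2 / D) hδ (by positivity)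
      (hZinj.mono (Finset.coe_subset.2 hZ')) fun z hz ↦ ?_).trans_eq ?_
    · obtain ⟨h1, h2⟩ := abs_lt.1 (hx z hz)
      have h3 : 2 / D = 1 / D + 1 / D := by ring
      simp only [id, h3]
      constructor <;> linarith
    · rw [div_div, mul_comm D]
  rw [hPcard] at hfar
  have hz : ∀ z ∈ Z, (S.card : ℝ) ^ 3 ≤
      Q * (4 * τ * (S.card : ℝ) ^ 3 + farCollisions P 1 D z) := by
    intro z hz
    have h1 := card_pow_four_le P 1 z
    have h2 := collisions_le one_pos hPinj D z
    rw [hPcard] at h1 h2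
    have h3 : (((P ×ˢ P).image fun x ↦ ⌊(x.1 + z * x.2) / 1⌋).card : ℝ) ≤ Q * S.card := by
      refine le_trans ?_ (hZ z hz)
      norm_cast
      refine Finset.card_le_card fun k hk ↦ ?_
      obtain ⟨x, hx, rfl⟩ := Finset.mem_image.1 hk
      obtain ⟨hx1, hx2⟩ := Finset.mem_product.1 hx
      obtain ⟨n, hn, hn'⟩ := Finset.mem_map.1 hx1
      obtain ⟨m, hm, hm'⟩ := Finset.mem_map.1 hx2
      refine Finset.mem_add.2 ⟨n, hn, ⌊z * m⌋, Finset.mem_image_of_mem _ hm, ?_⟩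
      rw [← hn', ← hm', div_one]
      exact (Int.floor_intCast_add _ _).symm
    have h4 : (S.card : ℝ) * (S.card : ℝ) ^ 3 ≤
        S.card * (Q * (4 * τ * (S.card : ℝ) ^ 3 + farCollisions P 1 D z)) := by
      calc (S.card : ℝ) * (S.card : ℝ) ^ 3 = (S.card : ℝ) ^ 4 := by ring
        _ ≤ _ := h1
        _ ≤ Q * S.card * (4 * (S.card * (τ * (S.card : ℝ) ^ 2)) + farCollisions P 1 D z) := by
            gcongr
            exact h2.trans (by gcongr)
        _ = _ := by ring
    exact le_of_mul_le_mul_left h4 hN0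
  have hsum := Finset.sum_le_sum hz
  rw [Finset.sum_const, nsmul_eq_mul, ← Finset.mul_sum, Finset.sum_add_distrib, Finset.sum_const,
    nsmul_eq_mul] at hsum
  have h5 : (S.card : ℝ) ^ 3 * Z.card ≤
      (S.card : ℝ) ^ 3 * (Q * (4 * τ * Z.card + (2 / (δ * D) + 2) * S.card)) := by
    calc (S.card : ℝ) ^ 3 * Z.card = Z.card * (S.card : ℝ) ^ 3 := mul_comm _ _
      _ ≤ _ := hsum
      _ ≤ Q * (Z.card * (4 * τ * (S.card : ℝ) ^ 3) + (2 / (δ * D) + 2) * (S.card : ℝ) ^ 4) := by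
          gcongr
      _ = _ := by ring
  exact le_of_mul_le_mul_left h5 (by positivity)

/-! ### Supports of Frostman measures -/

section Frostman

variable {κ C : ℝ} {μ : Measure ℝ}

/-- Points of the support that lie in the same cell of length `r` cannot all be at distance at most
`t`, unless there are many cells. -/
lemma IsFrostmanMeasure.one_le_cellCount_mul (hμ : IsFrostmanMeasure κ C μ)
    (hsupp : μ.support ⊆ Set.Icc 0 1) (hC : 0 ≤ C) {r t : ℝ} (hr : 0 < r) (ht : 0 < t)
    (h : ∀ x ∈ μ.support, ∀ y ∈ μ.support, ⌊x / r⌋ = ⌊y / r⌋ → |x - y| ≤ t) :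
    1 ≤ cellCount μ.support r 1 * (C * t ^ κ) := by
  obtain ⟨hprob, hfrost⟩ := hμ
  set F := (finite_cells (G := μ.support) (R := 1) hr).toFinset with hF
  have hcov : μ.support ⊆ ⋃ k ∈ F, {x ∈ μ.support | ⌊x / r⌋ = k} := by
    intro x hx
    have hx1 := hsupp hx
    refine Set.mem_biUnion (x := ⌊x / r⌋) ?_ ⟨hx, rfl⟩
    rw [hF, Set.Finite.coe_toFinset]
    exact ⟨x, ⟨hx, by linarith [hx1.1], hx1.2⟩, rfl⟩
  have h1 : (1 : ℝ≥0∞) ≤ F.card * ENNReal.ofReal (C * t ^ κ) := by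
    calc (1 : ℝ≥0∞) = μ Set.univ := measure_univ.symm
      _ = μ μ.support := (measure_eq_measure_of_null_sdiff (Set.subset_univ _) (by
          rw [← Set.compl_eq_univ_sdiff]; exact Measure.measure_compl_support)).symm
      _ ≤ μ (⋃ k ∈ F, {x ∈ μ.support | ⌊x / r⌋ = k}) := measure_mono hcov
      _ ≤ ∑ k ∈ F, μ {x ∈ μ.support | ⌊x / r⌋ = k} := measure_biUnion_finset_le _ _
      _ ≤ ∑ k ∈ F, ENNReal.ofReal (C * t ^ κ) := by
          refine Finset.sum_le_sum fun k hk ↦ ?_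
          rw [hF, Set.Finite.mem_toFinset] at hk
          obtain ⟨x, ⟨hx, -⟩, rfl⟩ := hk
          refine (measure_mono fun y hy ↦ ?_).trans (hfrost x hx t ht)
          rw [Metric.mem_closedBall, Real.dist_eq]
          exact h y hy.1 x hx hy.2
      _ = _ := by rw [Finset.sum_const, nsmul_eq_mul]
  have h2 : F.card = cellCount μ.support r 1 := by
    rw [cellCount, Set.ncard_eq_toFinset_card _ (finite_cells hr)]
  have h3 : (0 : ℝ) ≤ C * t ^ κ := by positivity
  rw [h2, ← ENNReal.ofReal_natCast, ← ENNReal.ofReal_mul (by positivity), ENNReal.one_le_ofReal]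
    at h1
  exact h1

lemma IsFrostmanMeasure.exists_le_mem_support (hμ : IsFrostmanMeasure κ C μ)
    (hsupp : μ.support ⊆ Set.Icc 0 1) {t : ℝ} (ht : 0 < t) (h : C * t ^ κ < 1) :
    ∃ x ∈ μ.support, t ≤ x := by
  by_contra! hcon
  obtain ⟨hprob, hfrost⟩ := hμ
  have huniv : μ μ.support = 1 := by
    rw [← measure_univ (μ := μ)]
    exact measure_eq_measure_of_null_sdiff (Set.subset_univ _) (by
          rw [← Set.compl_eq_univ_sdiff]; exact Measure.measure_compl_support)
  have hne : μ.support.Nonempty := by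
    by_contra hne
    rw [Set.not_nonempty_iff_eq_empty.1 hne, measure_empty] at huniv
    exact zero_ne_one huniv
  obtain ⟨x, hx⟩ := hne
  have h1 : μ μ.support ≤ ENNReal.ofReal (C * t ^ κ) := by
    refine (measure_mono fun y hy ↦ ?_).trans (hfrost x hx t ht)
    rw [Metric.mem_closedBall, Real.dist_eq, abs_le]
    have h1 := hcon y hy
    have h2 := hcon x hx
    have h3 := (hsupp hx).1
    have h4 := (hsupp hy).1
    constructor <;> linarith
  rw [huniv, ENNReal.one_le_ofReal] at h1
  linarith

end Frostman

/-! ### Discretisation of unions of intervals -/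

section Discretisation

variable {δ : ℝ}

lemma ofReal_mul_card_le_volume (hδ : 0 < δ) (Q : Finset ℤ) {E : Set ℝ}
    (hE : ∀ k ∈ Q, Set.Ico (k * δ) (k * δ + δ) ⊆ E) :
    ENNReal.ofReal (δ * Q.card) ≤ volume E := by
  calc ENNReal.ofReal (δ * Q.card) = ∑ k ∈ Q, volume (Set.Ico ((k : ℝ) * δ) (k * δ + δ)) := by
        simp only [Real.volume_Ico, add_sub_cancel_left, Finset.sum_const, nsmul_eq_mul]
        rw [mul_comm, ENNReal.ofReal_mul (by positivity), ENNReal.ofReal_natCast]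
    _ = volume (⋃ k ∈ Q, Set.Ico ((k : ℝ) * δ) (k * δ + δ)) := by
        refine (measure_biUnion_finset (fun k _ l _ hkl ↦ ?_) fun k _ ↦ measurableSet_Ico).symm
        rw [Function.onFun, Set.disjoint_left]
        intro x hx hx'
        exact hkl (((floor_div_eq_iff hδ).2 hx).symm.trans ((floor_div_eq_iff hδ).2 hx'))
    _ ≤ volume E := measure_mono (Set.iUnion₂_subset hE)

/-- A finite union of closed balls of radius `δ` is comparable to a union of cells `[n δ, (n+1) δ)`,
where `n` runs over a finite set `S`. -/
lemma exists_discretisation (hδ : 0 < δ) (s : Finset ℝ) :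
    ∃ S : Finset ℤ, (s.Nonempty → S.Nonempty) ∧
      ENNReal.ofReal (δ * S.card) ≤ volume (⋃ y ∈ s, Metric.closedBall y δ) ∧
      volume (⋃ y ∈ s, Metric.closedBall y δ) ≤ ENNReal.ofReal (3 * δ * S.card) ∧
      (∀ z ∈ Set.Icc (0 : ℝ) 1, ENNReal.ofReal (δ * (S + S.image (fun a : ℤ ↦ ⌊z * a⌋)).card) ≤
        3 * volume ((⋃ y ∈ s, Metric.closedBall y δ) + z • ⋃ y ∈ s, Metric.closedBall y δ)) ∧
      ∀ n ∈ S, ∃ x ∈ ⋃ y ∈ s, Metric.closedBall y δ, ∀ D : ℝ,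
        ENNReal.ofReal (δ * (S.filter fun m : ℤ ↦ |(n : ℝ) - m| < D).card) ≤
          volume ((⋃ y ∈ s, Metric.closedBall y δ) ∩ Metric.closedBall x ((D + 2) * δ)) := by
  classical
  set U := ⋃ y ∈ s, Metric.closedBall y δ with hU
  set S := s.image fun y ↦ ⌊y / δ⌋ with hS
  have hrep : ∀ n ∈ S, ∃ y ∈ s, n * δ ≤ y ∧ y < n * δ + δ := by
    intro n hn
    obtain ⟨y, hy, e⟩ := Finset.mem_image.1 hn
    exact ⟨y, hy, (floor_div_eq_iff hδ).1 e⟩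
  have hball : ∀ y ∈ s, ∀ x : ℝ, |x - y| ≤ δ → x ∈ U := fun y hy x hx ↦
    Set.mem_biUnion hy (by rwa [Metric.mem_closedBall, Real.dist_eq])
  have hcell : ∀ n ∈ S, Set.Ico ((n : ℝ) * δ) (n * δ + δ) ⊆ U := by
    intro n hn x hx
    obtain ⟨y, hy, h1, h2⟩ := hrep n hn
    exact hball y hy x (abs_le.2 ⟨by linarith [hx.1], by linarith [hx.2]⟩)
  refine ⟨S, fun h ↦ h.image _, ofReal_mul_card_le_volume hδ S hcell, ?_, fun z hz ↦ ?_,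
    fun n hn ↦ ?_⟩
  · have hsub : U ⊆ ⋃ n ∈ S, Set.Icc ((n : ℝ) * δ - δ) (n * δ + 2 * δ) := by
      refine Set.iUnion₂_subset fun y hy x hx ↦ ?_
      rw [Metric.mem_closedBall, Real.dist_eq, abs_le] at hx
      have h1 := (floor_div_eq_iff (k := ⌊y / δ⌋) hδ).1 rfl
      exact Set.mem_biUnion (x := ⌊y / δ⌋) (Finset.mem_image_of_mem _ hy)
        ⟨by linarith, by linarith⟩
    calc volume U ≤ ∑ n ∈ S, volume (Set.Icc ((n : ℝ) * δ - δ) (n * δ + 2 * δ)) :=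
          (measure_mono hsub).trans (measure_biUnion_finset_le _ _)
      _ = ∑ n ∈ S, ENNReal.ofReal (3 * δ) := by
          refine Finset.sum_congr rfl fun n _ ↦ ?_
          rw [Real.volume_Icc]
          congr 1
          ring
      _ = ENNReal.ofReal (3 * δ * S.card) := by
          rw [Finset.sum_const, nsmul_eq_mul, mul_comm,
            ENNReal.ofReal_mul (p := 3 * δ) (by positivity), ENNReal.ofReal_natCast]
  · choose! f hf hf1 hf2 using hrep
    set Q := (S ×ˢ S).image fun x ↦ ⌊(f x.1 + z * f x.2) / δ⌋ with hQ
    have hQU : ENNReal.ofReal (δ * Q.card) ≤ volume (U + z • U) := by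
      refine ofReal_mul_card_le_volume hδ Q fun k hk x hx ↦ ?_
      obtain ⟨⟨n, m⟩, hnm, rfl⟩ := Finset.mem_image.1 hk
      obtain ⟨hn, hm⟩ := Finset.mem_product.1 hnm
      have h1 := (floor_div_eq_iff (x := f n + z * f m) (k := ⌊(f n + z * f m) / δ⌋) hδ).1 rfl
      dsimp only at hx
      refine Set.mem_add.2 ⟨x - z * f m, hball _ (hf n hn) _
        (abs_le.2 ⟨by linarith [hx.1], by linarith [hx.2]⟩), z * f m, ?_, by ring⟩
      exact Set.smul_mem_smul_set (hball _ (hf m hm) _ (by simpa using hδ.le))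
    have hsub : S + S.image (fun a : ℤ ↦ ⌊z * a⌋) ⊆ Q - Finset.Icc 0 2 := by
      intro k hk
      obtain ⟨n, hn, l, hl, rfl⟩ := Finset.mem_add.1 hk
      obtain ⟨m, hm, rfl⟩ := Finset.mem_image.1 hl
      refine Finset.mem_sub.2 ⟨⌊(f n + z * f m) / δ⌋,
        Finset.mem_image.2 ⟨(n, m), Finset.mem_product.2 ⟨hn, hm⟩, rfl⟩,
        ⌊(f n + z * f m) / δ⌋ - (n + ⌊z * m⌋), ?_, by ring⟩
      have h1 := Int.floor_le (z * (m : ℝ))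
      have h2 := Int.lt_floor_add_one (z * (m : ℝ))
      have h3 : (n : ℝ) + ⌊z * m⌋ ≤ (f n + z * f m) / δ := by
        rw [le_div_iff₀ hδ]
        have h4 : z * (m * δ) ≤ z * f m := mul_le_mul_of_nonneg_left (hf1 m hm) hz.1
        have h5 : (⌊z * m⌋ : ℝ) * δ ≤ z * m * δ := by gcongr
        linarith [hf1 n hn]
      have h4 : (f n + z * f m) / δ < n + ⌊z * m⌋ + 3 := by
        rw [div_lt_iff₀ hδ]
        have h4 : z * f m ≤ z * (m * δ + δ) := mul_le_mul_of_nonneg_left (hf2 m hm).le hz.1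
        have h5 : z * m * δ ≤ (⌊z * m⌋ + 1 : ℝ) * δ := by gcongr
        have h6 : z * δ ≤ 1 * δ := mul_le_mul_of_nonneg_right hz.2 hδ.le
        linarith [hf2 n hn]
      have h5 : n + ⌊z * m⌋ ≤ ⌊(f n + z * f m) / δ⌋ := Int.le_floor.2 (by push_cast; exact h3)
      have h6 : ⌊(f n + z * f m) / δ⌋ < n + ⌊z * m⌋ + 3 := Int.floor_lt.2 (by push_cast; exact h4)
      rw [Finset.mem_Icc]
      omega
    have hcard : ((S + S.image (fun a : ℤ ↦ ⌊z * a⌋)).card : ℝ) ≤ Q.card * 3 :=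
      (Nat.cast_le.2 (Finset.card_le_card hsub)).trans (card_sub_le_mul le_rfl (by simp))
    calc ENNReal.ofReal (δ * (S + S.image (fun a : ℤ ↦ ⌊z * a⌋)).card)
        ≤ ENNReal.ofReal (3 * (δ * Q.card)) := by
          refine ENNReal.ofReal_le_ofReal ?_
          calc _ ≤ δ * (Q.card * 3) := by gcongr
            _ = _ := by ring
      _ = 3 * ENNReal.ofReal (δ * Q.card) := by
          rw [ENNReal.ofReal_mul (by norm_num), ENNReal.ofReal_ofNat]
      _ ≤ _ := by gcongr
  · obtain ⟨y, hy, h1, h2⟩ := hrep n hn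
    refine ⟨y, hball y hy y (by simpa using hδ.le), fun D ↦ ?_⟩
    refine ofReal_mul_card_le_volume hδ _ fun m hm x hx ↦ ?_
    obtain ⟨hm, hmn⟩ := Finset.mem_filter.1 hm
    refine ⟨hcell m hm hx, ?_⟩
    rw [Metric.mem_closedBall, Real.dist_eq]
    obtain ⟨h3, h4⟩ := abs_lt.1 hmn
    have h5 : (n - m : ℝ) * δ ≤ D * δ := by gcongr
    have h6 : (m - n : ℝ) * δ ≤ D * δ := by gcongr; linarith
    exact abs_le.2 ⟨by linarith [hx.1], by linarith [hx.2]⟩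

end Discretisation

/-! ### Proof of the theorem -/

/-- A filtered ring that contains the support of a Frostman measure fills the unit interval, up to a
small power of the scale, after a bounded number of steps. -/
lemma exists_level_cellCount_ge {η κ : ℝ} (hη : 0 < η) (hη1 : η ≤ 1) (hκ : 0 < κ) :
    ∃ J : ℕ, 1 ≤ J ∧ ∀ (G : ℕ → Set ℝ) (lam C : ℝ) (μ : Measure ℝ), IsFilteredRing G →
      0 < lam → lam ≤ 1 / 1000 → 0 ≤ C → C ≤ lam⁻¹ → IsFrostmanMeasure κ C μ →
      μ.support ⊆ Set.Icc 0 1 → μ.support ⊆ G 0 →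
      lam⁻¹ ^ ((1 - η) * J) ≤ (cellCount (G (2 + J + 20 * (J + 1) ^ 2)) (lam ^ J) 1 : ℝ) := by
  obtain ⟨c, hc⟩ := exists_nat_ge (3 / κ)
  rw [div_le_iff₀ hκ] at hc
  obtain ⟨J, hJ1, hJ⟩ := exists_cellCount_ge hη hη1 hκ c
  refine ⟨J, hJ1, fun G lam C μ hG hlam hlam1 hC0 hC hμ hsupp hsub ↦ ?_⟩
  have hlam1' : lam ≤ 1 := by linarith
  have h0 : ∀ n : ℕ, 0 < lam ^ n := fun n ↦ pow_pos hlam n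
  -- two points of the support whose distance is neither too large nor too small
  obtain ⟨w, hw, hw1, hw2⟩ : ∃ w ∈ G 2, lam ^ c ≤ w ∧ w ≤ lam := by
    by_contra! hcon
    have hle : ∀ x ∈ μ.support, ∀ y ∈ μ.support, |x - y| ≤ lam → x - y ≤ lam ^ c := by
      intro x hx y hy hxy
      by_contra! hlt
      have h1 := hcon (x - y) (hG.sub_mem (hsub hx) (hsub hy)) hlt.le
      linarith [(abs_le.1 hxy).2]
    have h1 := hμ.one_le_cellCount_mul hsupp hC0 hlam (h0 c) fun x hx y hy e ↦ by
      have h2 := (floor_div_eq_iff (x := x) (k := ⌊x / lam⌋) hlam).1 rfl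
      have h3 := (floor_div_eq_iff (x := y) (k := ⌊x / lam⌋) hlam).1 e.symm
      have h4 : |x - y| ≤ lam := abs_le.2 ⟨by linarith, by linarith⟩
      have h5 := hle x hx y hy h4
      have h6 := hle y hy x hx (by rwa [abs_sub_comm])
      exact abs_le.2 ⟨by linarith, h5⟩
    have h2 := cellCount_le (G := μ.support) hlam (zero_le_one' ℝ)
    have h3 : (lam ^ c) ^ κ ≤ lam ^ 3 := by
      rw [← Real.rpow_natCast, ← Real.rpow_mul hlam.le, ← Real.rpow_natCast lam 3]
      exact Real.rpow_le_rpow_of_exponent_ge hlam hlam1' (by push_cast; exact hc)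
    have h4 : (1 : ℝ) ≤ (2 * 1 / lam + 2) * (lam⁻¹ * lam ^ 3) :=
      h1.trans (by gcongr)
    have h5 : (2 * 1 / lam + 2) * (lam⁻¹ * lam ^ 3) = 2 * lam + 2 * lam ^ 2 := by
      field_simp
    rw [h5] at h4
    nlinarith
  have hw0 : 0 < w := (h0 c).trans_le hw1
  have hwpow : ∀ m : ℕ, w ^ m ∈ G (2 + m) := by
    intro m
    induction m with
    | zero => simpa using hG.mono (Nat.zero_le 2) hG.one_mem
    | succ m ih =>
      rw [pow_succ']
      exact hG.mul_mem (2 + m) _ (hG.mono (by omega) hw) _ ih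
        (by rw [abs_of_pos hw0]; linarith)
  obtain ⟨i, hi, hstab⟩ := hG.exists_stable_level hlam hlam1 (2 + J) J
  set G' : ℕ → Set ℝ := fun k ↦ G (2 + J + 20 * i + k) with hG'
  have hstable : IsStableRing G' lam J c :=
    { toIsFilteredRing := hG.shift _
      pos := hlam
      le_small := hlam1
      stable := fun j hj ↦ hstab j hj
      exists_mem := by
        intro y hy hy1
        have hex : ∃ m : ℕ, w ^ m ≤ y := ⟨J, (pow_le_pow_left₀ hw0.le hw2 J).trans hy⟩
        classical
        set m := Nat.find hex with hm
        have hmy : w ^ m ≤ y := Nat.find_spec hex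
        have hmJ : m ≤ J := Nat.find_min' hex ((pow_le_pow_left₀ hw0.le hw2 J).trans hy)
        refine ⟨w ^ m, hG.mono (by omega) (hwpow m), ?_, hmy⟩
        rcases Nat.eq_zero_or_pos m with h | h
        · rw [h, pow_zero]
          exact mul_le_one₀ (pow_le_one₀ hlam.le hlam1') (by linarith [h0 J]) hy1
        · have h1 : y < w ^ (m - 1) := not_le.1 (Nat.find_min hex (by omega))
          calc lam ^ c * y ≤ w * w ^ (m - 1) :=
                mul_le_mul hw1 h1.le (by linarith [h0 J]) hw0.le
            _ = w ^ m := by rw [← pow_succ', Nat.sub_add_cancel h] }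
  have hlow : ∀ j ≤ J, lam⁻¹ ^ (κ * j - 1) ≤ (cellCount (G' 0) (lam ^ j) 1 : ℝ) := by
    intro j hj
    have h1 := hμ.one_le_cellCount_mul hsupp hC0 (h0 j) (h0 j) fun x hx y hy e ↦ by
      have h2 := (floor_div_eq_iff (x := x) (k := ⌊x / lam ^ j⌋) (h0 j)).1 rfl
      have h3 := (floor_div_eq_iff (x := y) (k := ⌊x / lam ^ j⌋) (h0 j)).1 e.symm
      exact abs_le.2 ⟨by linarith, by linarith⟩
    have h2 : (cellCount μ.support (lam ^ j) 1 : ℝ) ≤ cellCount (G' 0) (lam ^ j) 1 := by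
      exact_mod_cast cellCount_mono (h0 j)
        (hsub.trans (hG.mono (Nat.zero_le (2 + J + 20 * i + 0)))) le_rfl
    have h3 : (lam ^ j) ^ κ = lam ^ (κ * j) := by
      rw [← Real.rpow_natCast, ← Real.rpow_mul hlam.le, mul_comm]
    have h4 : lam⁻¹ ^ (κ * j - 1) = (lam⁻¹ * lam ^ (κ * j))⁻¹ := by
      rw [Real.rpow_sub_one (by positivity), Real.inv_rpow hlam.le, mul_inv, inv_inv]
      field_simp
    rw [h4, inv_le_iff_one_le_mul₀ (by positivity)]
    calc (1 : ℝ) ≤ cellCount μ.support (lam ^ j) 1 * (C * (lam ^ j) ^ κ) := h1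
      _ ≤ cellCount (G' 0) (lam ^ j) 1 * (lam⁻¹ * lam ^ (κ * j)) := by
          rw [h3]; gcongr
  refine (hJ G' lam hstable hlow).trans ?_
  exact_mod_cast cellCount_mono (h0 J) (hG.mono (by omega)) le_rfl

/-- The multipliers of `S`, with constants that increase along the filtration, form a filtered
ring. -/
lemma isFilteredRing_multipliers {S : Finset ℤ} {L : ℝ} (hS : S.Nonempty) (hL : 11 ≤ L)
    (hF : SumsetCovered S L) : IsFilteredRing fun i ↦ {z | IsMultiplier S (L ^ 5 ^ i) z} := by
  have hle : ∀ i : ℕ, L ≤ L ^ 5 ^ i := fun i ↦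
    le_self_pow₀ (by linarith) (pow_pos (by norm_num) i).ne'
  have hpow : ∀ i : ℕ, L ^ 5 ^ (i + 1) = (L ^ 5 ^ i) ^ 5 := fun i ↦ by rw [pow_succ, pow_mul]
  refine ⟨fun i z hz ↦ hz.mono ?_, isMultiplier_one hS (by simp; linarith), fun i z hz ↦ ?_,
    fun i z hz w hw ↦ ?_, fun i z hz w hw hz4 ↦ ?_⟩
  · exact pow_le_pow_right₀ (by linarith) (Nat.pow_le_pow_right (by norm_num) (Nat.le_succ i))
  · rw [Set.mem_ofPred_eq, hpow]
    exact IsMultiplier.neg (hL.trans (hle i)) hz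
  · rw [Set.mem_ofPred_eq, hpow]
    exact IsMultiplier.add (hL.trans (hle i)) (hF.mono (hle i)) hz hw
  · rw [Set.mem_ofPred_eq, hpow]
    exact IsMultiplier.mul (hL.trans (hle i)) (hF.mono (hle i)) hz hw hz4

lemma rpow_neg_le_rpow_neg {δ x y : ℝ} (hδ : 0 < δ) (hδ1 : δ < 1) (h : x ≤ y) :
    δ ^ (-x) ≤ δ ^ (-y) :=
  Real.rpow_le_rpow_of_exponent_ge hδ hδ1.le (by linarith)

/-- Small expansion along the support of a Frostman measure, which contains a point that is not too
small, forces small doubling. -/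
lemma IsFrostmanMeasure.card_sub_le {κ ε δ : ℝ} {μ : Measure ℝ} {S : Finset ℤ} (hκ : 0 < κ)
    (hκ1 : κ < 1) (hε0 : 0 < ε) (hδ : 0 < δ) (hδ1 : δ < 1) (hδε : 1000 ≤ δ ^ (-ε))
    (hμ : IsFrostmanMeasure κ (δ ^ (-ε)) μ) (hsupp : μ.support ⊆ Set.Icc 0 1)
    (hXadd : ∀ x ∈ μ.support,
      ((S + S.image (fun a : ℤ ↦ ⌊x * a⌋)).card : ℝ) ≤ 9 * δ ^ (-ε) * S.card) :
    ((S - S).card : ℝ) ≤ δ ^ (-(5 * ε / κ)) * S.card := by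
  have hεκ : ε ≤ ε / κ := by
    rw [le_div_iff₀ hκ]
    have : ε * κ ≤ ε * 1 := by gcongr
    linarith
  obtain ⟨x, hx, hxt⟩ := hμ.exists_le_mem_support hsupp
    (Real.rpow_pos_of_pos hδ (2 * ε / κ)) (by
      rw [← Real.rpow_mul hδ.le, ← Real.rpow_add hδ]
      refine Real.rpow_lt_one hδ.le hδ1 ?_
      rw [div_mul_cancel₀ _ hκ.ne']
      linarith)
  have hx0 : 0 < x := (Real.rpow_pos_of_pos hδ _).trans_le hxt
  refine (card_sub_le_of_card_add_le hx0 (hsupp hx).2 (hXadd x hx)).trans ?_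
  gcongr
  have h1 : 3 / x ≤ 3 * δ ^ (-(2 * ε / κ)) := by
    rw [div_le_iff₀ hx0, mul_assoc, Real.rpow_neg hδ.le]
    have : 1 ≤ (δ ^ (2 * ε / κ))⁻¹ * x := by
      rw [inv_mul_eq_div, one_le_div (Real.rpow_pos_of_pos hδ _)]
      exact hxt
    linarith
  calc 3 / x * (9 * δ ^ (-ε)) ^ 2 ≤ 3 * δ ^ (-(2 * ε / κ)) * (9 * δ ^ (-ε)) ^ 2 := by gcongr
    _ = 243 * (δ ^ (-(2 * ε / κ)) * δ ^ (-ε) * δ ^ (-ε)) := by ring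
    _ ≤ δ ^ (-ε) * (δ ^ (-(2 * ε / κ)) * δ ^ (-ε) * δ ^ (-ε)) := by gcongr; linarith
    _ = δ ^ (-(2 * ε / κ + 3 * ε)) := by
        simp only [← Real.rpow_add hδ]
        congr 1
        ring
    _ ≤ δ ^ (-(5 * ε / κ)) := by
        refine rpow_neg_le_rpow_neg hδ hδ1 ?_
        rw [mul_div_assoc, mul_div_assoc]
        linarith

/-- If all elements of `Z` expand `S` by little, then `Z` is small, because dilations by the elements
of a large set expand `S` on average. -/
lemma card_lt_of_card_add_le {κ σ θ ε δ : ℝ} {S : Finset ℤ} {Z : Finset ℝ} (hS : S.Nonempty)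
    (hκ : 0 < κ) (hκ1 : κ < 1) (hσ : 1 - σ = 4 * θ) (hθ0 : 0 < θ) (hθ1 : θ ≤ 1 / 4)
    (hε : ε ≤ θ * κ / 4) (hδ : 0 < δ) (hδ1 : δ < 1) (hδε : 1000 ≤ δ ^ (-ε))
    (hSσ : (S.card : ℝ) ≤ δ ^ (-σ))
    (hSclose : ∀ n ∈ S, ∀ D : ℝ, 0 < D → ((S.filter fun m : ℤ ↦ |(n : ℝ) - m| < D).card : ℝ) ≤
      3 * δ ^ (-ε) * ((D + 2) * δ) ^ κ * S.card)
    (hZinj : Set.InjOn (fun z : ℝ ↦ ⌊z / δ⌋) (Z : Set ℝ))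
    (hZadd : ∀ z ∈ Z, ((S + S.image (fun a : ℤ ↦ ⌊z * a⌋)).card : ℝ) ≤
      δ ^ (-(θ * κ / 2)) * S.card) :
    (Z.card : ℝ) < δ ^ (-(1 - θ)) := by
  by_contra! hZlow
  set Q : ℝ := δ ^ (-(θ * κ / 2)) with hQ
  set D : ℝ := δ ^ θ / δ with hD
  have hD0 : 0 < D := by positivity
  have hδD : δ * D = δ ^ θ := by rw [hD]; field_simp
  have hδθ : δ ≤ δ ^ θ := by
    calc δ = δ ^ (1 : ℝ) := (Real.rpow_one δ).symm
      _ ≤ δ ^ θ := Real.rpow_le_rpow_of_exponent_ge hδ hδ1.le (by linarith)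
  set τ : ℝ := 9 * (δ ^ (-ε) * δ ^ (θ * κ)) with hτ
  have hclose : ∀ n ∈ S, ((S.filter fun m : ℤ ↦ |(n : ℝ) - m| < D).card : ℝ) ≤ τ * S.card := by
    intro n hn
    refine (hSclose n hn D hD0).trans ?_
    have h5 : (D + 2) * δ ≤ 3 * δ ^ θ := by
      rw [add_mul, mul_comm D, hδD]
      linarith
    have h4 : ((D + 2) * δ) ^ κ ≤ 3 * δ ^ (θ * κ) := by
      calc ((D + 2) * δ) ^ κ ≤ (3 * δ ^ θ) ^ κ := by gcongr
        _ = 3 ^ κ * δ ^ (θ * κ) := by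
            rw [Real.mul_rpow (by norm_num) (by positivity), ← Real.rpow_mul hδ.le]
        _ ≤ 3 ^ (1 : ℝ) * δ ^ (θ * κ) := by
            gcongr
            norm_num
        _ = 3 * δ ^ (θ * κ) := by rw [Real.rpow_one]
    calc 3 * δ ^ (-ε) * ((D + 2) * δ) ^ κ * S.card
        ≤ 3 * δ ^ (-ε) * (3 * δ ^ (θ * κ)) * S.card := by gcongr
      _ = τ * S.card := by rw [hτ]; ring
  have hfinal := card_le_of_card_add_le S hS Z hδ hD0 (by positivity) hZinj hZadd hclose
  have hZ0 : 0 < (Z.card : ℝ) := (Real.rpow_pos_of_pos hδ _).trans_le hZlow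
  rw [hδD] at hfinal
  -- the contribution of the close pairs
  have hterm1 : Q * (4 * τ) ≤ 36 * δ ^ (θ * κ / 4) := by
    have h1 : Q * (δ ^ (-ε) * δ ^ (θ * κ)) ≤ δ ^ (θ * κ / 4) := by
      rw [hQ, ← Real.rpow_add hδ, ← Real.rpow_add hδ]
      refine Real.rpow_le_rpow_of_exponent_ge hδ hδ1.le ?_
      linarith
    rw [hτ]
    linarith
  -- the contribution of the other pairs
  have hterm2 : Q * ((2 / δ ^ θ + 2) * S.card) ≤ 4 * δ ^ (θ * κ / 4) * Z.card := by
    have h1 : 2 / δ ^ θ + 2 ≤ 4 * δ ^ (-θ) := by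
      rw [Real.rpow_neg hδ.le, div_eq_mul_inv]
      have : 1 ≤ (δ ^ θ)⁻¹ := by
        rw [one_le_inv₀ (by positivity)]
        exact Real.rpow_le_one hδ.le hδ1.le hθ0.le
      linarith
    calc Q * ((2 / δ ^ θ + 2) * S.card) ≤ Q * (4 * δ ^ (-θ) * δ ^ (-σ)) := by gcongr
      _ = 4 * δ ^ (-(θ * κ / 2) + (-θ + -σ)) := by
          rw [Real.rpow_add hδ, Real.rpow_add hδ, hQ]; ring
      _ ≤ 4 * δ ^ (θ * κ / 4 + -(1 - θ)) := by
          gcongr 4 * ?_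
          refine Real.rpow_le_rpow_of_exponent_ge hδ hδ1.le ?_
          have h2 : θ * κ ≤ θ * 1 := by gcongr
          linarith
      _ = 4 * δ ^ (θ * κ / 4) * δ ^ (-(1 - θ)) := by rw [Real.rpow_add hδ]; ring
      _ ≤ _ := by gcongr
  have hsmall : δ ^ (θ * κ / 4) ≤ 1 / 1000 := by
    rw [one_div, le_inv_comm₀ (by positivity) (by norm_num), ← Real.rpow_neg hδ.le]
    exact hδε.trans (rpow_neg_le_rpow_neg hδ hδ1 hε)
  have h1 : (Z.card : ℝ) ≤ 40 * δ ^ (θ * κ / 4) * Z.card := by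
    calc (Z.card : ℝ) ≤ Q * (4 * τ * Z.card + (2 / δ ^ θ + 2) * S.card) := hfinal
      _ = Q * (4 * τ) * Z.card + Q * ((2 / δ ^ θ + 2) * S.card) := by ring
      _ ≤ 36 * δ ^ (θ * κ / 4) * Z.card + 4 * δ ^ (θ * κ / 4) * Z.card := by gcongr
      _ = _ := by ring
  have h2 : 40 * δ ^ (θ * κ / 4) * Z.card ≤ 40 * (1 / 1000) * (Z.card : ℝ) := by gcongr
  linarith

/-- The discretised form of the theorem. -/
lemma exists_card_add_gt {κ σ : ℝ} (hκ : 0 < κ) (hκσ : κ ≤ σ) (hσ : σ < 1) :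
    ∃ ε : ℝ, 0 < ε ∧ ε ≤ 1 ∧ ∀ δ : ℝ, 0 < δ → δ < 1 → 1000 ≤ δ ^ (-ε) →
      ∀ S : Finset ℤ, S.Nonempty → (S.card : ℝ) ≤ δ ^ (-σ) →
        (∀ n ∈ S, ∀ D : ℝ, 0 < D → ((S.filter fun m : ℤ ↦ |(n : ℝ) - m| < D).card : ℝ) ≤
          3 * δ ^ (-ε) * ((D + 2) * δ) ^ κ * S.card) →
        ∀ μ : Measure ℝ, IsFrostmanMeasure κ (δ ^ (-ε)) μ → μ.support ⊆ Set.Icc 0 1 →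
          ∃ x ∈ μ.support,
            9 * δ ^ (-ε) * S.card < ((S + S.image (fun a : ℤ ↦ ⌊x * a⌋)).card : ℝ) := by
  set θ : ℝ := (1 - σ) / 4 with hθ
  have hθ0 : 0 < θ := by rw [hθ]; linarith
  have hθ1 : θ ≤ 1 / 4 := by rw [hθ]; linarith
  have hκ1 : κ < 1 := by linarith
  obtain ⟨J, hJ1, hJ⟩ := exists_level_cellCount_ge hθ0 (by linarith) hκ
  set q := 2 + J + 20 * (J + 1) ^ 2 with hq
  -- the multipliers at level `0` have constant `δ ^ (-α)`, those at level `q` have constant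
  -- `δ ^ (-α * 5 ^ q)`, which is still a small power of `δ`
  set α : ℝ := θ * κ / (6 * 5 ^ q) with hα
  set ε : ℝ := α * κ / 25 with hε
  have h5q : (J : ℝ) ≤ 5 ^ q := by
    have h1 : q < 5 ^ q := Nat.lt_pow_self (by norm_num)
    have h2 : J ≤ 5 ^ q := by omega
    exact_mod_cast h2
  have hJ1' : (1 : ℝ) ≤ J := by exact_mod_cast hJ1
  have hα0 : 0 < α := by positivity
  have hαq : α * (6 * 5 ^ q) = θ * κ := by rw [hα]; field_simp
  have hε0 : 0 < ε := by positivity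
  have hεα : ε ≤ α := by
    rw [hε]
    have : α * κ ≤ α * 1 := by gcongr
    linarith
  have hθκ : θ * κ ≤ 1 / 4 := by
    calc θ * κ ≤ 1 / 4 * 1 := by gcongr
      _ = 1 / 4 := by norm_num
  have hαJ : α * J ≤ 1 / 24 := by
    have : α * J ≤ α * 5 ^ q := by gcongr
    linarith
  have hα6 : 6 * α ≤ θ * κ := by
    have : α * 1 ≤ α * 5 ^ q := by gcongr; linarith
    linarith
  have hεJ : ε ≤ 1 / J := by
    rw [le_div_iff₀ (by linarith)]
    have : ε * J ≤ α * J := by gcongr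
    linarith
  have hε1 : ε ≤ 1 := by linarith
  refine ⟨ε, hε0, hε1, fun δ hδ hδ1 hδε S hS hSσ hSclose μ hμ hsupp ↦ ?_⟩
  by_contra! hXadd
  have hanti : ∀ {x y : ℝ}, x ≤ y → δ ^ (-x) ≤ δ ^ (-y) := fun h ↦ rpow_neg_le_rpow_neg hδ hδ1 h
  -- `K` bounds the doubling of `S`, and `L = K ^ 5` is the constant at level `0` of the filtration
  set L : ℝ := δ ^ (-α) with hL
  have hLε : 1000 ≤ L := hδε.trans (hanti hεα)
  set K : ℝ := δ ^ (-(5 * ε / κ)) with hK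
  have hεκ : ε ≤ ε / κ := by
    rw [le_div_iff₀ hκ]
    have : ε * κ ≤ ε * 1 := by gcongr
    linarith
  have hK1 : 1 ≤ K := by
    refine le_trans ?_ (hδε.trans (hanti (show ε ≤ 5 * ε / κ from ?_)))
    · norm_num
    · rw [mul_div_assoc]; linarith
  have hK5 : K ^ 5 = L := by
    rw [hK, hL, ← Real.rpow_natCast, ← Real.rpow_mul hδ.le]
    congr 1
    rw [hε]
    push_cast
    field_simp
    norm_num
  have hKL : K ≤ L := by
    rw [← hK5]
    exact le_self_pow₀ hK1 (by norm_num)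
  have hdoubling : ((S - S).card : ℝ) ≤ K * S.card :=
    hμ.card_sub_le hκ hκ1 hε0 hδ hδ1 hδε hsupp hXadd
  have hcov : SumsetCovered S L := hK5 ▸ sumsetCovered_of_card_sub_le hS hdoubling
  -- the ring of multipliers has almost full covering number at scale `δ`
  set lam : ℝ := δ ^ (1 / J : ℝ) with hlam
  have hJ0 : (J : ℝ) ≠ 0 := by linarith
  have hlam0 : 0 < lam := Real.rpow_pos_of_pos hδ _
  have hlaminv : lam⁻¹ = δ ^ (-(1 / J : ℝ)) := (Real.rpow_neg hδ.le _).symm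
  have hlamε : δ ^ (-ε) ≤ lam⁻¹ := by rw [hlaminv]; exact hanti hεJ
  have hlam1 : lam ≤ 1 / 1000 := by
    rw [one_div, le_inv_comm₀ hlam0 (by norm_num)]
    exact hδε.trans hlamε
  have hlamJ : lam ^ J = δ := by
    rw [hlam, ← Real.rpow_natCast, ← Real.rpow_mul hδ.le, one_div_mul_cancel hJ0, Real.rpow_one]
  have hG := isFilteredRing_multipliers hS (by linarith : 11 ≤ L) hcov
  have hfull := hJ _ lam (δ ^ (-ε)) μ hG hlam0 hlam1 (by positivity) hlamε hμ hsupp fun x hx ↦ by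
    refine (isMultiplier_of_card_add_le hS (hXadd x hx)).mono ?_
    have h1 : 9 * δ ^ (-ε) ≤ δ ^ (-ε) * δ ^ (-ε) := by gcongr; linarith
    rw [pow_zero, pow_one]
    refine h1.trans ?_
    rw [← Real.rpow_add hδ, ← neg_add]
    refine hanti ?_
    rw [hε]
    have : α * κ ≤ α * 1 := by gcongr
    linarith
  rw [hlamJ] at hfull
  obtain ⟨Z, hZ, hZinj, hZcard⟩ := exists_cell_representatives
    {z | IsMultiplier S (L ^ 5 ^ q) z} hδ 1
  have hZlow : δ ^ (-(1 - θ)) ≤ (Z.card : ℝ) := by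
    rw [hZcard]
    refine le_trans (le_of_eq ?_) hfull
    rw [hlaminv, ← Real.rpow_mul hδ.le]
    congr 1
    field_simp
  -- all multipliers expand `S` by little, which contradicts the average expansion
  set Q : ℝ := δ ^ (-(θ * κ / 2)) with hQ
  have hQL : (L ^ 5 ^ q) ^ 3 = Q := by
    rw [hL, hQ, ← Real.rpow_natCast, ← Real.rpow_natCast, ← Real.rpow_mul hδ.le,
      ← Real.rpow_mul hδ.le]
    congr 1
    push_cast
    linarith
  have hLq : L ≤ L ^ 5 ^ q := le_self_pow₀ (by linarith) (pow_pos (by norm_num) q).ne'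
  have hZadd : ∀ z ∈ Z, ((S + S.image (fun a : ℤ ↦ ⌊z * a⌋)).card : ℝ) ≤ Q * S.card := by
    intro z hz
    rw [← hQL]
    exact IsMultiplier.card_add_le hS (hcov.mono hLq)
      (hdoubling.trans (by gcongr; exact hKL.trans hLq)) (hZ z hz).1
  have hlt := card_lt_of_card_add_le hS hκ hκ1 (by rw [hθ]; ring) hθ0 hθ1 (by linarith) hδ hδ1 hδε
    hSσ hSclose hZinj hZadd
  linarith

theorem theorem2 (κ σ : ℝ) (hκ : 0 < κ) (hκσ : κ ≤ σ) (hσ : σ < 1) :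
    ∃ c ∈ Set.Ioc (0 : ℝ) 1, ∃ ε ∈ Set.Ioc (0 : ℝ) 1, ∃ δ₀ ∈ Set.Ioc (0 : ℝ) 1,
      ∀ δ : ℝ, 0 < δ → δ < δ₀ →
        ∀ A : Set ℝ, A.Nonempty → IsDeltaSet δ κ (δ ^ (-ε)) A →
          volume A ≤ ENNReal.ofReal (δ ^ (1 - σ)) →
        ∀ μ : Measure ℝ, IsFrostmanMeasure κ (δ ^ (-ε)) μ → μ.support ⊆ Set.Icc 0 1 →
          ∃ x ∈ μ.support, ENNReal.ofReal (δ ^ (-c)) * volume A < volume (A + x • A) := by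
  obtain ⟨ε, hε0, hε1, hε⟩ := exists_card_add_gt hκ hκσ hσ
  refine ⟨ε, ⟨hε0, hε1⟩, ε, ⟨hε0, hε1⟩, (1000 : ℝ) ^ (-(1 / ε)), ⟨by positivity, ?_⟩, ?_⟩
  · exact Real.rpow_le_one_of_one_le_of_nonpos (by norm_num) (by
      rw [neg_nonpos]; positivity)
  intro δ hδ hδδ A hA hAδ hAvol μ hμ hsupp
  by_contra! hcon
  -- the choice of `δ₀` gives `δ ^ (-ε) ≥ 1000`, which absorbs all absolute constants
  have hδε : 1000 ≤ δ ^ (-ε) := by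
    have h1 : ((1000 : ℝ) ^ (-(1 / ε))) ^ (-ε) ≤ δ ^ (-ε) :=
      Real.rpow_le_rpow_of_nonpos hδ hδδ.le (by linarith)
    rwa [← Real.rpow_mul (by norm_num), neg_mul_neg, one_div, inv_mul_cancel₀ hε0.ne',
      Real.rpow_one] at h1
  have hδ1 : δ < 1 := by
    by_contra! h
    have := Real.rpow_le_one_of_one_le_of_nonpos h (by linarith : -ε ≤ 0)
    linarith
  obtain ⟨⟨s, rfl⟩, hAfrost⟩ := hAδ
  set A := ⋃ y ∈ s, Metric.closedBall y δ with hAdef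
  have hs : s.Nonempty := by
    obtain ⟨x, hx⟩ := hA
    obtain ⟨y, hy, -⟩ := Set.mem_iUnion₂.1 hx
    exact ⟨y, hy⟩
  obtain ⟨S, hSne, hSlow, hSup, hSadd, hSfrost⟩ := exists_discretisation hδ s
  rw [← hAdef] at hSlow hSup hSadd hSfrost
  have hS := hSne hs
  have hSσ : (S.card : ℝ) ≤ δ ^ (-σ) := by
    have h1 := (ENNReal.ofReal_le_ofReal_iff (by positivity)).1 (hSlow.trans hAvol)
    rw [sub_eq_add_neg, Real.rpow_add hδ, Real.rpow_one] at h1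
    exact le_of_mul_le_mul_left h1 hδ
  have hXadd : ∀ x ∈ μ.support,
      ((S + S.image (fun a : ℤ ↦ ⌊x * a⌋)).card : ℝ) ≤ 9 * δ ^ (-ε) * S.card := by
    intro x hx
    have h1 : ENNReal.ofReal (δ * (S + S.image (fun a : ℤ ↦ ⌊x * a⌋)).card) ≤
        ENNReal.ofReal (3 * (δ ^ (-ε) * (3 * δ * S.card))) := by
      calc _ ≤ 3 * volume (A + x • A) := hSadd x (hsupp hx)
        _ ≤ 3 * (ENNReal.ofReal (δ ^ (-ε)) * ENNReal.ofReal (3 * δ * S.card)) := by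
            gcongr
            exact (hcon x hx).trans (by gcongr)
        _ = _ := by
            rw [← ENNReal.ofReal_mul (by positivity), ENNReal.ofReal_mul (p := 3) (by norm_num),
              ENNReal.ofReal_ofNat]
    rw [ENNReal.ofReal_le_ofReal_iff (by positivity)] at h1
    have h2 : δ * (S + S.image (fun a : ℤ ↦ ⌊x * a⌋)).card ≤
        δ * (9 * δ ^ (-ε) * S.card) := h1.trans_eq (by ring)
    exact le_of_mul_le_mul_left h2 hδ
  have hSclose : ∀ n ∈ S, ∀ D : ℝ, 0 < D →
      ((S.filter fun m : ℤ ↦ |(n : ℝ) - m| < D).card : ℝ) ≤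
        3 * δ ^ (-ε) * ((D + 2) * δ) ^ κ * S.card := by
    intro n hn D hD
    obtain ⟨x, hx, h1⟩ := hSfrost n hn
    have h2 := hAfrost x hx ((D + 2) * δ) (by nlinarith)
    have h3 : ENNReal.ofReal (δ * (S.filter fun m : ℤ ↦ |(n : ℝ) - m| < D).card) ≤
        ENNReal.ofReal (δ ^ (-ε) * ((D + 2) * δ) ^ κ * (3 * δ * S.card)) := by
      rw [ENNReal.ofReal_mul (p := δ ^ (-ε) * ((D + 2) * δ) ^ κ) (by positivity)]
      exact (h1 D).trans (h2.trans (by gcongr))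
    rw [ENNReal.ofReal_le_ofReal_iff (by positivity)] at h3
    have h4 : δ * (S.filter fun m : ℤ ↦ |(n : ℝ) - m| < D).card ≤
        δ * (3 * δ ^ (-ε) * ((D + 2) * δ) ^ κ * S.card) := h3.trans_eq (by ring)
    exact le_of_mul_le_mul_left h4 hδ
  obtain ⟨x, hx, hlt⟩ := hε δ hδ hδ1 hδε S hS hSσ hSclose μ hμ hsupp
  exact absurd (hXadd x hx) (not_le.2 hlt)
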